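/- Let $M$ be a smooth manifold (without boundary) of odd dimension $2n+1$, equipped with a smooth $1$-form $\vartheta$ and a smooth $2$-form $\omega$ such that $\vartheta\wedge(d\vartheta+\omega)^n\neq 0$ everywhere on $M$ (a twisted contact manifold). For a bivector field $\Lambda$ let $\Lambda^\#:T^*M\to TM$ be the morphism with $\langle\beta,\Lambda^\#(\alpha)\rangle=\Lambda(\alpha,\beta)$. Then there are a unique vector field $E$ and a unique bivector field $\Lambda$ on $M$ such that $$i(E)\vartheta=1,\qquad i(E)(d\vartheta+\omega)=0,$$ $$\Lambda^\#(\vartheta)=0,\qquad i(\Lambda^\#(\alpha))(d\vartheta+\omega)=-(\alpha-\langle\alpha,E\rangle\,\vartheta)\quad\text{for all covectors }\alpha ;$$ both are smooth, and $((\Lambda,E),\omega)$ satisfies the twisted Jacobi equations $$[\Lambda,\Lambda]+2E\wedge\Lambda=2\Lambda^\#(d\omega)+2(\Lambda^\#\omega)\wedge E,$$ $$[E,\Lambda]=(\Lambda^\#\otimes 1)(d\omega)(E)-\big((\Lambda^\#\otimes 1)(\omega)(E)\big)\wedge E .$$ Here $[\cdot,\cdot]$ is the Schouten bracket, normalised by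 $[X_1\wedge\dots\wedge X_p,Y_1\wedge\dots\wedge Y_q]=\sum_{i,j}(-1)^{i+j}[X_i,Y_j]\wedge X_1\wedge\cdots\widehat{X_i}\cdots\wedge X_p\wedge Y_1\wedge\cdots\widehat{Y_j}\cdots\wedge Y_q$, and for a $k$-form $\eta$, $\Lambda^\#(\eta)(\alpha_1,\dots,\alpha_k)=(-1)^k\eta(\Lambda^\#\alpha_1,\dots,\Lambda^\#\alpha_k)$ and $(\Lambda^\#\otimes 1)(\eta)(X)(\alpha_1,\dots,\alpha_{k-1})=(-1)^k\eta(\Lambda^\#\alpha_1,\dots,\Lambda^\#\alpha_{k-1},X)$. Moreover $((\Lambda,E),\omega)$ is a twisted Jacobi structure on $M$, that is, $$\tfrac12[(\Lambda,E),(\Lambda,E)]^{(0,1)}=(\Lambda,E)^\#(d\omega,\omega).$$ Here $(\Lambda,E)$ is the section of $\bigwedge^2(TM\times\mathbb R)$ given by $(\Lambda,E)((\alpha,f),(\beta,g))=\Lambda(\alpha,\beta)+f\langle\beta,E\rangle-g\langle\alpha,E\rangle$; the morphism $(\Lambda,E)^\#:T^*M\times\mathbb R\to TM\times\mathbb R$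 is $(\Lambda,E)^\#(\alpha,f)=(\Lambda^\#(\alpha)+fE,-\langle\alpha,E\rangle)$, extended to sections $\zeta$ of $\bigwedge^3(T^*M\times\mathbb R)$ by $(\Lambda,E)^\#(\zeta)(a_1,a_2,a_3)=-\zeta((\Lambda,E)^\#a_1,(\Lambda,E)^\#a_2,(\Lambda,E)^\#a_3)$; the section $(d\omega,\omega)$ of $\bigwedge^3(T^*M\times\mathbb R)$ is $$(d\omega,\omega)((X_1,f_1),(X_2,f_2),(X_3,f_3))=d\omega(X_1,X_2,X_3)+f_1\,\omega(X_2,X_3)+f_2\,\omega(X_3,X_1)+f_3\,\omega(X_1,X_2);$$ and $[\cdot,\cdot]^{(0,1)}$ is the Schouten bracket $[\cdot,\cdot]$ (same normalisation) of the Lie algebroid $TM\times\mathbb R$ with bracket $[(X,f),(Y,g)]=([X,Y],X(g)-Y(f))$ and anchor the first projection, modified by the $1$-cocycle $\phi=(0,1)$: for $P$ of degree $p$ and $Q$ of degree $q$, $[P,Q]^\phi=[P,Q]+(p-1)\,P\wedge i_\phi Q+(-1)^p(q-1)\,i_\phi P\wedge Q$. -/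

import Mathlib

open scoped Manifold

noncomputable section

namespace TwistedJacobi

section PointwiseAlgebra

variable {W : Type*} [AddCommGroup W] [Module ℝ W] [TopologicalSpace W]

/-- Alternating `k`-forms on `W`, that is `⋀ᵏ W*`. -/
abbrev Form (k : ℕ) (W : Type*) [AddCommGroup W] [Module ℝ W] [TopologicalSpace W] : Type _ :=
  W [⋀^Fin k]→L[ℝ] ℝ

/-- `k`-vectors on the finite-dimensional space `W`, that is `⋀ᵏ W`, realised as the alternating
`k`-forms on the dual of `W`: a `k`-vector is evaluated on `k` covectors. -/
abbrev MultiVec (k : ℕ) (W : Type*) [AddCommGroup W] [Module ℝ W] [TopologicalSpace W] : Type _ :=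
  (W →L[ℝ] ℝ) [⋀^Fin k]→L[ℝ] ℝ

/-- The tensor product `(v₁, …, v_{p+q}) ↦ α(v₁, …, v_p) β(v_{p+1}, …, v_{p+q})`. -/
def tensor {p q : ℕ} (α : Form p W) (β : Form q W) :
    ContinuousMultilinearMap ℝ (fun _ : Fin (p + q) => W) ℝ where
  toMultilinearMap := ((LinearMap.mul' ℝ ℝ).compMultilinearMap
    (α.toMultilinearMap.domCoprod β.toMultilinearMap)).domDomCongr finSumFinEquiv
  cont := by
    change Continuous fun v : Fin (p + q) → W =>
      α (fun i => v (Fin.castAdd q i)) * β (fun j => v (Fin.natAdd p j))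
    refine (α.cont.comp ?_).mul (β.cont.comp ?_) <;>
    exact continuous_pi fun _ => continuous_apply _

theorem tensor_apply {p q : ℕ} (α : Form p W) (β : Form q W) (v : Fin (p + q) → W) :
    tensor α β v = α (fun i => v (Fin.castAdd q i)) * β (fun j => v (Fin.natAdd p j)) := rfl

/-- The wedge product, with the determinant normalisation
`(α ∧ β)(v) = (p! q!)⁻¹ ∑_σ sign(σ) α(v_{σ(1)}, …, v_{σ(p)}) β(v_{σ(p+1)}, …, v_{σ(p+q)})`.
It serves for forms on `W` and, applied to the dual of `W`, for multivectors. -/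
def wedge {p q : ℕ} (α : Form p W) (β : Form q W) : Form (p + q) W :=
  ((p.factorial * q.factorial : ℕ) : ℝ)⁻¹ •
    ContinuousMultilinearMap.alternatization (tensor α β)

/-- The powers `Φ ∧ ⋯ ∧ Φ` (`n` factors) of a 2-form. -/
def wedgePow (Φ : Form 2 W) : (n : ℕ) → Form (2 * n) W
  | 0 => ContinuousAlternatingMap.constOfIsEmpty ℝ W (Fin 0) (1 : ℝ)
  | n + 1 => wedge (wedgePow Φ n) Φ

/-- The reindexing `v ↦ η(v ∘ σ)`. -/
def reindex {k l : ℕ} (σ : Fin k ≃ Fin l) (η : Form k W) : Form l W where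
  toFun v := η (fun i => v (σ i))
  map_update_add' := (η.toAlternatingMap.domDomCongr σ).map_update_add'
  map_update_smul' := (η.toAlternatingMap.domDomCongr σ).map_update_smul'
  map_eq_zero_of_eq' := (η.toAlternatingMap.domDomCongr σ).map_eq_zero_of_eq'
  cont := η.cont.comp (continuous_pi fun _ => continuous_apply _)

/-- The same form, with its degree rewritten along an equality of natural numbers. -/
def castDeg {k l : ℕ} (h : k = l) (η : Form k W) : Form l W :=
  reindex (finCongr h) η

/-- Interior product `i(w)η = η(w, ·, …, ·)`. -/
def intProd {k : ℕ} (w : W) (η : Form (k + 1) W) : Form k W where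
  toFun v := η (Matrix.vecCons w v)
  map_update_add' := (η.toAlternatingMap.curryLeft w).map_update_add'
  map_update_smul' := (η.toAlternatingMap.curryLeft w).map_update_smul'
  map_eq_zero_of_eq' := (η.toAlternatingMap.curryLeft w).map_eq_zero_of_eq'
  cont := η.cont.comp (continuous_const.matrixVecCons continuous_id)

/-- The contraction `η(·, …, ·, w)` in the last argument, see `intProdLast_apply`. -/
def intProdLast {k : ℕ} (w : W) (η : Form (k + 1) W) : Form k W :=
  intProd w (reindex (finRotate (k + 1)) η)

theorem intProdLast_apply {k : ℕ} (w : W) (η : Form (k + 1) W) (v : Fin k → W) :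
    intProdLast w η v = η (Fin.snoc v w : Fin (k + 1) → W) := by
  change η (fun i => (Matrix.vecCons w v) (finRotate (k + 1) i)) = _
  congr 1
  funext i
  refine Fin.lastCases ?_ (fun j => ?_) i
  · simp
  · rw [Fin.snoc_castSucc, finRotate_apply, Fin.coeSucc_eq_succ]
    rfl

/-- For `S : W* → W`, the extension of `S` to `k`-forms,
`S(η)(α₁, …, α_k) = (-1)ᵏ η(S α₁, …, S α_k)`. -/
def sharpForm {k : ℕ} (S : (W →L[ℝ] ℝ) →L[ℝ] W) (η : Form k W) : MultiVec k W :=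
  (-1 : ℝ) ^ k • η.compContinuousLinearMap S

/-- For `S : W* → W`, the `k`-vector
`(S ⊗ 1)(η)(α₁, …, α_k)(w) = (-1)ᵏ⁺¹ η(S α₁, …, S α_k, w)` obtained from a `(k+1)`-form `η`. -/
def sharpTensorOne {k : ℕ} (S : (W →L[ℝ] ℝ) →L[ℝ] W) (η : Form (k + 1) W) (w : W) :
    MultiVec k W :=
  (-1 : ℝ) ^ (k + 1) • (intProdLast w η).compContinuousLinearMap S

variable {W' : Type*} [AddCommGroup W'] [Module ℝ W'] [TopologicalSpace W']

/-- The push-forward `L_* P` of a `k`-vector by a linear map: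
`(L_* P)(α₁, …, α_k) = P(α₁ ∘ L, …, α_k ∘ L)`. -/
def push {k : ℕ} (L : W →L[ℝ] W') (P : MultiVec k W) : MultiVec k W' :=
  P.compContinuousLinearMap (L.precomp ℝ)

theorem push_apply {k : ℕ} (L : W →L[ℝ] W') (P : MultiVec k W) (α : Fin k → (W' →L[ℝ] ℝ)) :
    push L P α = P (fun i => (α i).comp L) := rfl

variable [ContinuousSMul ℝ W]

/-- A vector regarded as a 1-vector: `α ↦ ⟨α, w⟩`. -/
def vec (w : W) : MultiVec 1 W :=
  ContinuousAlternatingMap.ofSubsingleton ℝ (W →L[ℝ] ℝ) ℝ (0 : Fin 1)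
    { toFun := fun α => α w
      map_add' := fun _ _ => rfl
      map_smul' := fun _ _ => rfl
      cont := continuous_eval_const w }

theorem vec_apply (w : W) (α : Fin 1 → (W →L[ℝ] ℝ)) : vec w α = α 0 w := rfl

variable [IsTopologicalAddGroup W] [T2Space W] [FiniteDimensional ℝ W]

/-- The morphism `P^# : W* → W` of a bivector `P`, given by `⟨β, P^#(α)⟩ = P(α, β)`,
see `apply_sharp`. It is written in a basis `(eᵢ)` as `P^#(α) = ∑ᵢ P(α, eⁱ) eᵢ`. -/
def sharp (P : MultiVec 2 W) : (W →L[ℝ] ℝ) →L[ℝ] W :=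
  ∑ i, (P.toContinuousLinearMap
      ![0, LinearMap.toContinuousLinearMap ((Module.finBasis ℝ W).coord i)] 0).smulRight
    (Module.finBasis ℝ W i)

theorem apply_sharp (P : MultiVec 2 W) (α β : W →L[ℝ] ℝ) : β (sharp P α) = P ![α, β] := by
  have hβ : β = ∑ i, β (Module.finBasis ℝ W i) •
      LinearMap.toContinuousLinearMap ((Module.finBasis ℝ W).coord i) := by
    ext w
    conv_lhs => rw [← (Module.finBasis ℝ W).sum_repr w]
    rw [map_sum, sum_apply]
    refine Finset.sum_congr rfl fun i _ => ?_
    rw [map_smul]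
    exact mul_comm _ _
  have hlin : P ![α, β] = P.toContinuousLinearMap ![α, 0] 1 β := by
    change _ = P (Function.update ![α, 0] 1 β)
    congr 1
    funext i; fin_cases i <;> simp
  rw [hlin]
  conv_rhs => rw [hβ]
  rw [map_sum]
  have hs : sharp P α = ∑ i, P ![α, LinearMap.toContinuousLinearMap
      ((Module.finBasis ℝ W).coord i)] • Module.finBasis ℝ W i := by
    rw [sharp, sum_apply]
    refine Finset.sum_congr rfl fun i _ => ?_
    change P (Function.update (![0, LinearMap.toContinuousLinearMap
      ((Module.finBasis ℝ W).coord i)] : Fin 2 → (W →L[ℝ] ℝ)) 0 α) •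
        Module.finBasis ℝ W i = _
    congr 2
    funext j; fin_cases j <;> simp
  rw [hs, map_sum]
  refine Finset.sum_congr rfl fun i _ => ?_
  rw [map_smul, map_smul, smul_eq_mul, smul_eq_mul, mul_comm]
  congr 1
  change _ = P (Function.update _ 1 _)
  congr 1
  funext j; fin_cases j <;> simp

end PointwiseAlgebra

section Flat

variable {V : Type*} [NormedAddCommGroup V] [NormedSpace ℝ V] [FiniteDimensional ℝ V]
variable {A : Type*} [NormedAddCommGroup A] [NormedSpace ℝ A]

/-- The Schouten bracket, on the vector space `V`, of the multivector fields of degree `p + 1` and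
`q + 1` of the trivial Lie algebroid `V × A → V` with linear anchor `ρ : A → V`, in which constant
sections commute:
`[P, Q] = (-1)ᵖ ∑ᵢ i(ρ*eⁱ)P ∧ ∂ᵢQ - (-1)^{pq} (-1)^q ∑ᵢ i(ρ*eⁱ)Q ∧ ∂ᵢP`.
It is the graded extension of the bracket of sections such that
`[X₁ ∧ ⋯, Y₁ ∧ ⋯] = ∑ (-1)^{i+j} [Xᵢ, Yⱼ] ∧ X₁ ∧ ⋯ X̂ᵢ ⋯ ∧ Y₁ ∧ ⋯ Ŷⱼ ⋯`. -/
def schoutenFlat (ρ : A →L[ℝ] V) {p q : ℕ} (P : V → MultiVec (p + 1) A)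
    (Q : V → MultiVec (q + 1) A) (y : V) : MultiVec (p + q + 1) A :=
  let b := Module.finBasis ℝ V
  let e : Fin (Module.finrank ℝ V) → (A →L[ℝ] ℝ) :=
    fun i => (LinearMap.toContinuousLinearMap (b.coord i)).comp ρ
  (-1 : ℝ) ^ p • castDeg (by omega)
      (∑ i, wedge (intProd (e i) (P y)) (fderiv ℝ Q y (b i)))
    - (-1 : ℝ) ^ (p * q + q) • castDeg (by omega)
      (∑ i, wedge (intProd (e i) (Q y)) (fderiv ℝ P y (b i)))

end Flat

section Manifold

variable (V : Type*) [NormedAddCommGroup V] [NormedSpace ℝ V]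
variable {M : Type*} [TopologicalSpace M] [ChartedSpace V M]

/-- The tangent space at `x` of a manifold without boundary modelled on `V`. -/
abbrev T (x : M) : Type _ := TangentSpace 𝓘(ℝ, V) x

instance (x : M) : T2Space (T V x) := inferInstanceAs (T2Space V)

instance [FiniteDimensional ℝ V] (x : M) : FiniteDimensional ℝ (T V x) :=
  inferInstanceAs (FiniteDimensional ℝ V)

/-- The differential at `x` of the preferred chart at `x₀`. -/
def dChart (x₀ x : M) : T V x →L[ℝ] V :=
  mfderiv 𝓘(ℝ, V) 𝓘(ℝ, V) (extChartAt 𝓘(ℝ, V) x₀) x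

/-- The inverse of the differential at `x` of the preferred chart at `x₀`. -/
def dChartInv (x₀ x : M) : V →L[ℝ] T V x :=
  (dChart V x₀ x).inverse

variable (M) in
/-- Vector fields on `M`. -/
abbrev VecField : Type _ := ∀ x : M, T V x

variable (M) in
/-- Differential forms of degree `k` on `M`. -/
abbrev DiffForm (k : ℕ) : Type _ := ∀ x : M, Form k (T V x)

variable (M) in
/-- Multivector fields of degree `k` on `M`, i.e. sections of `⋀ᵏ TM`. -/
abbrev MultiVecField (k : ℕ) : Type _ := ∀ x : M, MultiVec k (T V x)

variable (M) in
/-- Sections of `⋀ᵏ (TM × ℝ)`. -/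
abbrev MultiVecFieldR (k : ℕ) : Type _ := ∀ x : M, MultiVec k (T V x × ℝ)

variable {V}

/-- The expression of a form in the preferred chart at `x₀`. -/
def formInChart {k : ℕ} (η : DiffForm V M k) (x₀ : M) (y : V) : Form k V :=
  (η ((extChartAt 𝓘(ℝ, V) x₀).symm y)).compContinuousLinearMap
    (dChartInv V x₀ ((extChartAt 𝓘(ℝ, V) x₀).symm y))

/-- The expression of a multivector field in the preferred chart at `x₀`. -/
def multiVecInChart {k : ℕ} (P : MultiVecField V M k) (x₀ : M) (y : V) : MultiVec k V :=
  push (dChart V x₀ ((extChartAt 𝓘(ℝ, V) x₀).symm y)) (P ((extChartAt 𝓘(ℝ, V) x₀).symm y))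

/-- The expression of a section of `⋀ᵏ (TM × ℝ)` in the preferred chart at `x₀`. -/
def multiVecRInChart {k : ℕ} (P : MultiVecFieldR V M k) (x₀ : M) (y : V) : MultiVec k (V × ℝ) :=
  push ((dChart V x₀ ((extChartAt 𝓘(ℝ, V) x₀).symm y)).prodMap (ContinuousLinearMap.id ℝ ℝ))
    (P ((extChartAt 𝓘(ℝ, V) x₀).symm y))

/-- Smooth vector fields. -/
def SmoothVecField [IsManifold 𝓘(ℝ, V) (⊤ : ℕ∞) M] (X : VecField V M) : Prop :=
  ContMDiff 𝓘(ℝ, V) 𝓘(ℝ, V).tangent (⊤ : ℕ∞) (fun x => (⟨x, X x⟩ : TangentBundle 𝓘(ℝ, V) M))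

/-- Smooth differential forms: the expressions in the charts are smooth. -/
def SmoothForm {k : ℕ} (η : DiffForm V M k) : Prop :=
  ∀ x₀ : M, ContDiffOn ℝ (⊤ : ℕ∞) (formInChart η x₀) (extChartAt 𝓘(ℝ, V) x₀).target

/-- Smooth multivector fields: the expressions in the charts are smooth. -/
def SmoothMultiVecField {k : ℕ} (P : MultiVecField V M k) : Prop :=
  ∀ x₀ : M, ContDiffOn ℝ (⊤ : ℕ∞) (multiVecInChart P x₀) (extChartAt 𝓘(ℝ, V) x₀).target

/-- The exterior derivative on `M`, computed at `x` in the preferred chart at `x`. -/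
def extDer {k : ℕ} (η : DiffForm V M k) : DiffForm V M (k + 1) := fun x =>
  (extDeriv (formInChart η x) (extChartAt 𝓘(ℝ, V) x x)).compContinuousLinearMap (dChart V x x)

variable [FiniteDimensional ℝ V]

/-- The Schouten bracket of multivector fields on `M`, computed at `x` in the preferred chart
at `x`. -/
def schouten {p q : ℕ} (P : MultiVecField V M (p + 1)) (Q : MultiVecField V M (q + 1)) :
    MultiVecField V M (p + q + 1) := fun x =>
  push (dChartInv V x x) (schoutenFlat (ContinuousLinearMap.id ℝ V)
    (multiVecInChart P x) (multiVecInChart Q x) (extChartAt 𝓘(ℝ, V) x x))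

/-- The Schouten bracket of the Lie algebroid `TM × ℝ`, whose anchor is the first projection and
whose bracket is `[(X, f), (Y, g)] = ([X, Y], X(g) - Y(f))`, computed at `x` in the preferred
chart at `x`. -/
def schoutenR {p q : ℕ} (P : MultiVecFieldR V M (p + 1)) (Q : MultiVecFieldR V M (q + 1)) :
    MultiVecFieldR V M (p + q + 1) := fun x =>
  push ((dChartInv V x x).prodMap (ContinuousLinearMap.id ℝ ℝ))
    (schoutenFlat (ContinuousLinearMap.fst ℝ V ℝ)
      (multiVecRInChart P x) (multiVecRInChart Q x) (extChartAt 𝓘(ℝ, V) x x))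

/-- The Schouten bracket of `TM × ℝ` modified by the 1-cocycle `φ = (0, 1)`:
`[P, Q]^φ = [P, Q] + (deg P - 1) P ∧ i(φ)Q + (-1)^{deg P} (deg Q - 1) i(φ)P ∧ Q`. -/
def schoutenMod {p q : ℕ} (P : MultiVecFieldR V M (p + 1)) (Q : MultiVecFieldR V M (q + 1)) :
    MultiVecFieldR V M (p + q + 1) := fun x =>
  schoutenR P Q x
    + (p : ℝ) • castDeg (by omega)
        (wedge (P x) (intProd (ContinuousLinearMap.snd ℝ (T V x) ℝ) (Q x)))
    + ((-1 : ℝ) ^ (p + 1) * (q : ℝ)) • castDeg (by omega)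
        (wedge (intProd (ContinuousLinearMap.snd ℝ (T V x) ℝ) (P x)) (Q x))

/-- The section of `⋀² (TM × ℝ)` determined by a bivector field and a vector field, that is
`Λ + (0, 1) ∧ E`, or `(Λ, E)((α, f), (β, g)) = Λ(α, β) + f ⟨β, E⟩ - g ⟨α, E⟩`. -/
def pair (L : MultiVecField V M 2) (E : VecField V M) : MultiVecFieldR V M 2 := fun x =>
  push (ContinuousLinearMap.inl ℝ (T V x) ℝ) (L x)
    + wedge (vec ((0, 1) : T V x × ℝ)) (vec ((E x, 0) : T V x × ℝ))

/-- The section of `⋀ᵏ⁺¹ (T*M × ℝ)` determined by a `(k+1)`-form `η` and a `k`-form `ξ`, here for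
`k = 2`:
`(η, ξ)((X₁, f₁), (X₂, f₂), (X₃, f₃)) = η(X₁, X₂, X₃) + f₁ ξ(X₂, X₃) + f₂ ξ(X₃, X₁) + f₃ ξ(X₁, X₂)`. -/
def pairForm (η : DiffForm V M 3) (ξ : DiffForm V M 2) (x : M) : Form 3 (T V x × ℝ) :=
  (η x).compContinuousLinearMap (ContinuousLinearMap.fst ℝ (T V x) ℝ)
    + wedge (p := 1) (q := 2)
        (ContinuousAlternatingMap.ofSubsingleton ℝ (T V x × ℝ) ℝ (0 : Fin 1)
          (ContinuousLinearMap.snd ℝ (T V x) ℝ))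
        ((ξ x).compContinuousLinearMap (ContinuousLinearMap.fst ℝ (T V x) ℝ))

/-- The morphism `(Λ, E)^# : T*M × ℝ → TM × ℝ`,
`(Λ, E)^#(α, f) = (Λ^#(α) + f E, -⟨α, E⟩)`. A covector `ζ` of `T_x M × ℝ` is `(α, f)` with
`α = ζ(·, 0)` and `f = ζ(0, 1)`. -/
def pairSharp (L : MultiVecField V M 2) (E : VecField V M) (x : M) :
    (T V x × ℝ →L[ℝ] ℝ) →L[ℝ] T V x × ℝ where
  toFun ζ := (sharp (L x) (ζ.comp (ContinuousLinearMap.inl ℝ (T V x) ℝ)) + ζ (0, 1) • E x,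
    -ζ (E x, 0))
  map_add' ζ ζ' := by
    ext
    · simp [add_smul]; abel
    · simp; ring
  map_smul' c ζ := by
    ext <;> simp [mul_smul]
  cont := by
    refine Continuous.prodMk (Continuous.add ?_ ?_) ?_
    · exact (sharp (L x)).continuous.comp
        ((ContinuousLinearMap.inl ℝ (T V x) ℝ).precomp ℝ).continuous
    · exact (continuous_eval_const _).smul continuous_const
    · exact (continuous_eval_const _).neg

/-- Twisted Jacobi structures `((Λ, E), ω)` on `M`:
`½ [(Λ, E), (Λ, E)]^{(0,1)} = (Λ, E)^#(dω, ω)`. -/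
structure IsTwistedJacobi [IsManifold 𝓘(ℝ, V) (⊤ : ℕ∞) M] (L : MultiVecField V M 2)
    (E : VecField V M) (ω : DiffForm V M 2) : Prop where
  smooth_bivector : SmoothMultiVecField L
  smooth_vector : SmoothVecField E
  smooth_form : SmoothForm ω
  equation : ∀ x : M, (2⁻¹ : ℝ) • (schoutenMod (pair L E) (pair L E) x : MultiVec 3 (T V x × ℝ))
    = sharpForm (pairSharp L E x) (pairForm (extDer ω) ω x)

/-- `[Λ, Λ] + 2 E ∧ Λ = 2 Λ^#(dω) + 2 (Λ^# ω) ∧ E`. -/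
def TwistedJacobiEq₁ (L : MultiVecField V M 2) (E : VecField V M) (ω : DiffForm V M 2) : Prop :=
  ∀ x : M, (schouten L L x : MultiVec 3 (T V x))
      + (2 : ℝ) • (wedge (vec (E x)) (L x) : MultiVec 3 (T V x))
    = (2 : ℝ) • (sharpForm (sharp (L x)) (extDer ω x) : MultiVec 3 (T V x))
      + (2 : ℝ) • (wedge (sharpForm (sharp (L x)) (ω x)) (vec (E x)) : MultiVec 3 (T V x))

/-- `[E, Λ] = (Λ^# ⊗ 1)(dω)(E) - ((Λ^# ⊗ 1)(ω)(E)) ∧ E`. -/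
def TwistedJacobiEq₂ (L : MultiVecField V M 2) (E : VecField V M) (ω : DiffForm V M 2) : Prop :=
  ∀ x : M, (schouten (p := 0) (q := 1) (fun z => vec (E z)) L x : MultiVec 2 (T V x))
    = (sharpTensorOne (sharp (L x)) (extDer ω x) (E x) : MultiVec 2 (T V x))
      - (wedge (sharpTensorOne (sharp (L x)) (ω x) (E x)) (vec (E x)) : MultiVec 2 (T V x))

/-- Twisted contact structures `(ϑ, ω)` on a manifold of dimension `2n + 1`: a smooth 1-form and a
smooth 2-form such that `ϑ ∧ (dϑ + ω)ⁿ` vanishes nowhere. -/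
structure IsTwistedContact (n : ℕ) (ϑ : DiffForm V M 1) (ω : DiffForm V M 2) : Prop where
  finrank_eq : Module.finrank ℝ V = 2 * n + 1
  smooth_one : SmoothForm ϑ
  smooth_two : SmoothForm ω
  nonvanishing : ∀ x : M, wedge (ϑ x) (wedgePow (extDer ϑ x + ω x) n) ≠ 0

/-- The conditions `i(E)ϑ = 1`, `i(E)(dϑ + ω) = 0`, `Λ^#(ϑ) = 0` and
`i(Λ^#(α))(dϑ + ω) = -(α - ⟨α, E⟩ ϑ)` for all covectors `α`. Forms of degree 1 are compared with
covectors by evaluation on tangent vectors. -/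
structure IsAssociatedPair (ϑ : DiffForm V M 1) (ω : DiffForm V M 2)
    (L : MultiVecField V M 2) (E : VecField V M) : Prop where
  reeb_one : ∀ x : M, ϑ x ![E x] = 1
  reeb_two : ∀ x : M, intProd (E x) (extDer ϑ x + ω x) = 0
  sharp_one : ∀ x : M, sharp (L x) ((ϑ x).toContinuousLinearMap 0 0) = 0
  sharp_two : ∀ (x : M) (α : T V x →L[ℝ] ℝ) (v : T V x),
    intProd (sharp (L x) α) (extDer ϑ x + ω x) ![v] = -(α v - α (E x) * ϑ x ![v])

end Manifold

end TwistedJacobi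
end

open TwistedJacobi

/-!
Write `Ω = dϑ + ω`. At each point, `w ↦ i(w)Ω + ϑ(w)ϑ` is an isomorphism from vectors to covectors:
its kernel lies in `ker ϑ ∩ ker Ω`, and a vector there would annihilate `ϑ ∧ Ωⁿ`. A vector killed
by `Ω` alone exists because the dimension is odd, so, normalised, it is the preimage `E` of `ϑ`, and
`Λ^#(α) = ⟨α, E⟩ E - (preimage of α)`. Hence `(Λ, E)` exists, is unique, and is smooth because
inversion of linear maps is.

Differentiating `Λ(β, γ) = Ω(Λ^#β, Λ^#γ)` and `Ω(Λ^#β, E) = 0` in a chart expresses the cyclic sum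
of the derivatives of `Λ`, and the Lie derivative of `Λ` along `E`, through `dΩ = dω` and
`dϑ = Ω - ω`. These two identities are the components of all three equations. The exterior
derivative commutes with changes of charts, so the defining relations of `(Λ, E)` hold throughout
the preferred chart at a point; that chart has identity differential at its centre.
-/

namespace TwistedJacobi

section LowDegree

variable {W : Type*} [AddCommGroup W] [Module ℝ W] [TopologicalSpace W]

theorem wedge_apply {p q : ℕ} (α : Form p W) (β : Form q W) (v : Fin (p + q) → W) :
    wedge α β v = ((p.factorial * q.factorial : ℕ) : ℝ)⁻¹ *
      ∑ σ : Equiv.Perm (Fin (p + q)), (σ.sign : ℤ) * tensor α β (v ∘ σ) := by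
  simp only [wedge, ContinuousAlternatingMap.smul_apply, smul_eq_mul,
    ContinuousMultilinearMap.alternatization_apply_apply, Units.smul_def, zsmul_eq_mul]

theorem sum_sign_mul_comp_perm_fin_two {X : Type*} (f : (Fin 2 → X) → ℝ) (u v : X) :
    ∑ σ : Equiv.Perm (Fin 2), (σ.sign : ℤ) * f (![u, v] ∘ σ) = f ![u, v] - f ![v, u] := by
  have huniv : (Finset.univ : Finset (Equiv.Perm (Fin 2))) = {1, Equiv.swap 0 1} := by decide
  have hswap : ![u, v] ∘ Equiv.swap (0 : Fin 2) 1 = ![v, u] := by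
    funext i; fin_cases i <;> rfl
  rw [huniv, Finset.sum_pair (by decide), Equiv.Perm.sign_swap (by decide), hswap]
  simp [sub_eq_add_neg]

theorem sum_sign_mul_comp_perm_fin_three {X : Type*} (f : (Fin 3 → X) → ℝ) (u v w : X) :
    ∑ σ : Equiv.Perm (Fin 3), (σ.sign : ℤ) * f (![u, v, w] ∘ σ) =
      f ![u, v, w] + f ![v, w, u] + f ![w, u, v] - f ![v, u, w] - f ![w, v, u] - f ![u, w, v] := by
  have huniv : (Finset.univ : Finset (Equiv.Perm (Fin 3))) =
      {1, finRotate 3, (finRotate 3)⁻¹, Equiv.swap 0 1, Equiv.swap 0 2, Equiv.swap 1 2} := by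
    decide
  have hrotate : Equiv.Perm.sign (finRotate 3) = 1 := by decide
  have hcomp : ∀ (σ : Equiv.Perm (Fin 3)) (x : Fin 3 → X),
      (∀ i, ![u, v, w] (σ i) = x i) → f (![u, v, w] ∘ σ) = f x :=
    fun σ x h => congrArg f (funext h)
  rw [huniv]
  repeat rw [Finset.sum_insert (by decide)]
  rw [Finset.sum_singleton, Equiv.Perm.sign_one, Equiv.Perm.sign_inv, hrotate,
    Equiv.Perm.sign_swap (by decide), Equiv.Perm.sign_swap (by decide),
    Equiv.Perm.sign_swap (by decide),
    hcomp 1 ![u, v, w] fun i => rfl,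
    hcomp (finRotate 3) ![v, w, u] fun i => by fin_cases i <;> rfl,
    hcomp (finRotate 3)⁻¹ ![w, u, v] fun i => by fin_cases i <;> rfl,
    hcomp (Equiv.swap 0 1) ![v, u, w] fun i => by fin_cases i <;> rfl,
    hcomp (Equiv.swap 0 2) ![w, v, u] fun i => by fin_cases i <;> rfl,
    hcomp (Equiv.swap 1 2) ![u, w, v] fun i => by fin_cases i <;> rfl]
  simp only [Units.val_one, Units.val_neg, Int.cast_one, Int.cast_neg]
  ring

theorem Form.eta_one (η : Form 1 W) (v : Fin 1 → W) : η v = η ![v 0] :=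
  congrArg η (List.ofFn_inj.1 rfl)

theorem Form.eta_two (η : Form 2 W) (v : Fin 2 → W) : η v = η ![v 0, v 1] :=
  congrArg η (List.ofFn_inj.1 rfl)

theorem Form.eta_three (η : Form 3 W) (v : Fin 3 → W) : η v = η ![v 0, v 1, v 2] :=
  congrArg η (List.ofFn_inj.1 rfl)

theorem Form.ext_one {η ξ : Form 1 W} (h : ∀ u, η ![u] = ξ ![u]) : η = ξ := by
  ext v; rw [η.eta_one, ξ.eta_one, h]

theorem Form.ext_two {η ξ : Form 2 W} (h : ∀ u v, η ![u, v] = ξ ![u, v]) : η = ξ := by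
  ext v; rw [η.eta_two, ξ.eta_two, h]

theorem Form.ext_three {η ξ : Form 3 W} (h : ∀ u v w, η ![u, v, w] = ξ ![u, v, w]) : η = ξ := by
  ext v; rw [η.eta_three, ξ.eta_three, h]

theorem Form.apply_self (η : Form 2 W) (u : W) : η ![u, u] = 0 :=
  η.map_eq_zero_of_eq ![u, u] (i := 0) (j := 1) rfl (by decide)

theorem Form.add_left (η : Form 2 W) (u v w : W) : η ![u + v, w] = η ![u, w] + η ![v, w] :=
  η.vecCons_add ![w] u v

theorem Form.smul_left (η : Form 2 W) (c : ℝ) (v w : W) : η ![c • v, w] = c * η ![v, w] :=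
  η.vecCons_smul ![w] c v

theorem Form.apply_swap (η : Form 2 W) (u v : W) : η ![u, v] = -η ![v, u] := by
  simpa using η.toAlternatingMap.map_swap ![v, u] (i := 0) (j := 1) (by decide)

theorem Form.add_right (η : Form 2 W) (u v w : W) : η ![u, v + w] = η ![u, v] + η ![u, w] := by
  rw [η.apply_swap, η.add_left, η.apply_swap v, η.apply_swap w]; ring

theorem Form.smul_right (η : Form 2 W) (c : ℝ) (u v : W) : η ![u, c • v] = c * η ![u, v] := by
  rw [η.apply_swap, η.smul_left, η.apply_swap v]; ring

theorem wedge_zero_two (α : Form 0 W) (β : Form 2 W) (u v : W) :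
    wedge α β ![u, v] = α ![] * β ![u, v] := by
  have htensor : ∀ x y, tensor α β ![x, y] = α ![] * β ![x, y] := fun x y => by
    rw [tensor_apply, β.eta_two, Subsingleton.elim (fun _ => _) ![]]
    rfl
  rw [wedge_apply]
  refine (congrArg _ (sum_sign_mul_comp_perm_fin_two (tensor α β) u v)).trans ?_
  rw [htensor, htensor, β.apply_swap v u]
  norm_num [Nat.factorial]
  ring

theorem wedge_one_one (α β : Form 1 W) (u v : W) :
    wedge α β ![u, v] = α ![u] * β ![v] - α ![v] * β ![u] := by
  have htensor : ∀ x y, tensor α β ![x, y] = α ![x] * β ![y] := fun x y => by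
    rw [tensor_apply, α.eta_one, β.eta_one]
    rfl
  rw [wedge_apply]
  refine (congrArg _ (sum_sign_mul_comp_perm_fin_two (tensor α β) u v)).trans ?_
  rw [htensor, htensor]
  norm_num [Nat.factorial]

theorem wedge_one_two (α : Form 1 W) (β : Form 2 W) (u v w : W) :
    wedge α β ![u, v, w] =
      α ![u] * β ![v, w] + α ![v] * β ![w, u] + α ![w] * β ![u, v] := by
  have htensor : ∀ x y z, tensor α β ![x, y, z] = α ![x] * β ![y, z] := fun x y z => by
    rw [tensor_apply, α.eta_one, β.eta_two]
    rfl
  rw [wedge_apply]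
  refine (congrArg _ (sum_sign_mul_comp_perm_fin_three (tensor α β) u v w)).trans ?_
  simp only [htensor]
  rw [β.apply_swap u w, β.apply_swap v u, β.apply_swap w v]
  norm_num [Nat.factorial]
  ring

theorem wedge_two_one (α : Form 2 W) (β : Form 1 W) (u v w : W) :
    wedge α β ![u, v, w] =
      α ![u, v] * β ![w] + α ![v, w] * β ![u] + α ![w, u] * β ![v] := by
  have htensor : ∀ x y z, tensor α β ![x, y, z] = α ![x, y] * β ![z] := fun x y z => by
    rw [tensor_apply, α.eta_two, β.eta_one]
    rfl
  rw [wedge_apply]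
  refine (congrArg _ (sum_sign_mul_comp_perm_fin_three (tensor α β) u v w)).trans ?_
  simp only [htensor]
  rw [α.apply_swap u w, α.apply_swap v u, α.apply_swap w v]
  norm_num [Nat.factorial]
  ring

theorem Form.comp_apply_one {W' : Type*} [AddCommGroup W'] [Module ℝ W'] [TopologicalSpace W']
    (η : Form 1 W') (f : W →L[ℝ] W') (u : W) :
    η.compContinuousLinearMap f ![u] = η ![f u] :=
  η.eta_one _

theorem Form.comp_apply_two {W' : Type*} [AddCommGroup W'] [Module ℝ W'] [TopologicalSpace W']
    (η : Form 2 W') (f : W →L[ℝ] W') (u v : W) :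
    η.compContinuousLinearMap f ![u, v] = η ![f u, f v] :=
  η.eta_two _

theorem Form.comp_apply_three {W' : Type*} [AddCommGroup W'] [Module ℝ W'] [TopologicalSpace W']
    (η : Form 3 W') (f : W →L[ℝ] W') (u v w : W) :
    η.compContinuousLinearMap f ![u, v, w] = η ![f u, f v, f w] :=
  η.eta_three _

theorem push_two_apply {W' : Type*} [AddCommGroup W'] [Module ℝ W'] [TopologicalSpace W']
    (f : W →L[ℝ] W') (P : MultiVec 2 W) (α β : W' →L[ℝ] ℝ) :
    push f P ![α, β] = P ![α.comp f, β.comp f] :=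
  Form.eta_two P _

end LowDegree

section InKernel

variable {W : Type*} [AddCommGroup W] [Module ℝ W] [TopologicalSpace W]

/-- The vector `w` is in the kernel of the form `η`: `η` vanishes as soon as one of its arguments
is `w`. -/
def InKernel {k : ℕ} (w : W) (η : Form k W) : Prop :=
  ∀ (v : Fin k → W) (i : Fin k), v i = w → η v = 0

theorem inKernel_one_iff {w : W} {θ : Form 1 W} : InKernel w θ ↔ θ ![w] = 0 := by
  refine ⟨fun h => h _ 0 rfl, fun h v i hi => ?_⟩
  rw [θ.eta_one, ← h, ← hi, Subsingleton.elim i 0]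

theorem inKernel_two_iff {w : W} {Ω : Form 2 W} : InKernel w Ω ↔ ∀ v, Ω ![w, v] = 0 := by
  refine ⟨fun h v => h _ 0 rfl, fun h v => Fin.forall_fin_two.2 ⟨?_, ?_⟩⟩ <;> rintro rfl
  · rw [Ω.eta_two, h]
  · rw [Ω.eta_two, Ω.apply_swap, h, neg_zero]

theorem InKernel.wedge {p q : ℕ} {w : W} {α : Form p W} {β : Form q W}
    (hα : InKernel w α) (hβ : InKernel w β) : InKernel w (wedge α β) := by
  intro v i hi
  rw [wedge_apply]
  refine mul_eq_zero_of_right _ (Finset.sum_eq_zero fun σ _ => mul_eq_zero_of_right _ ?_)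
  obtain ⟨j, rfl⟩ := σ.surjective i
  rw [tensor_apply]
  induction j using Fin.addCases with
  | left j => exact mul_eq_zero_of_left (hα _ j hi) _
  | right j => exact mul_eq_zero_of_right _ (hβ _ j hi)

theorem InKernel.wedgePow {w : W} {Φ : Form 2 W} (h : InKernel w Φ) :
    ∀ n, InKernel w (wedgePow Φ n)
  | 0 => fun _ i => i.elim0
  | n + 1 => (h.wedgePow n).wedge h

theorem InKernel.eq_zero_of_finrank_eq [FiniteDimensional ℝ W] {k : ℕ} {w : W} {η : Form k W}
    (h : InKernel w η) (hw : w ≠ 0) (hk : Module.finrank ℝ W = k) : η = 0 := by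
  have hli : LinearIndepOn ℝ id {w} := LinearIndepOn.singleton hw
  let b := Module.Basis.extend hli
  let e := b.indexEquiv (Module.finBasisOfFinrankEq ℝ W hk)
  have hmem : w ∈ hli.extend (Set.subset_univ _) := hli.subset_extend _ rfl
  refine ContinuousAlternatingMap.toAlternatingMap_injective
    ((b.reindex e).ext_alternating fun v hv => ?_)
  obtain ⟨i, hi⟩ := Finite.injective_iff_surjective.1 hv (e ⟨w, hmem⟩)
  exact h _ i (by simp [hi, b])

end InKernel

section BilinForm

theorem det_eq_zero_of_transpose_eq_neg {K ι : Type*} [Field K] [NeZero (2 : K)] [Fintype ι]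
    [DecidableEq ι] {A : Matrix ι ι K} (hA : A.transpose = -A) (hι : Odd (Fintype.card ι)) :
    A.det = 0 := by
  have hdet : A.det = -A.det := by
    simpa only [A.det_transpose, Matrix.det_neg, hι.neg_one_pow, neg_one_mul] using
      congrArg Matrix.det hA
  refine (mul_eq_zero.1 ?_).resolve_left (two_ne_zero (α := K))
  linear_combination hdet

theorem ker_ne_bot_of_isAlt_of_odd_finrank {K U : Type*} [Field K] [NeZero (2 : K)]
    [AddCommGroup U] [Module K U] [FiniteDimensional K U] {B : U →ₗ[K] U →ₗ[K] K}
    (hB : B.IsAlt) (hU : Odd (Module.finrank K U)) : LinearMap.ker B ≠ ⊥ := by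
  let b := Module.finBasis K U
  rw [Ne, ← LinearMap.separatingLeft_iff_ker_eq_bot,
    LinearMap.separatingLeft_iff_det_ne_zero b, not_not]
  refine det_eq_zero_of_transpose_eq_neg ?_ (by rwa [Fintype.card_fin])
  ext i j
  simp only [Matrix.transpose_apply, Matrix.neg_apply, LinearMap.toMatrix₂_apply, hB.neg]

end BilinForm

section ContactMap

variable {W : Type*} [AddCommGroup W] [Module ℝ W] [TopologicalSpace W]

/-- A 1-form regarded as a covector. -/
noncomputable def Form.covector (θ : Form 1 W) : W →L[ℝ] ℝ := θ.toContinuousLinearMap 0 0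

theorem Form.covector_apply (θ : Form 1 W) (v : W) : θ.covector v = θ ![v] :=
  θ.eta_one _

/-- The morphism `w ↦ i(w)Ω` from vectors to covectors defined by a 2-form. -/
noncomputable def Form.flat (Ω : Form 2 W) : W →ₗ[ℝ] W →L[ℝ] ℝ where
  toFun w := (intProd w Ω).covector
  map_add' u v := by ext w; exact Ω.vecCons_add _ u v
  map_smul' c v := by ext w; exact Ω.vecCons_smul _ c v

theorem Form.flat_apply (Ω : Form 2 W) (w v : W) : Ω.flat w v = Ω ![w, v] :=
  (intProd w Ω).covector_apply v

/-- Nondegeneracy of a pair `(θ, Ω)`: the kernels of `θ` and `Ω` meet trivially. -/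
def Nondeg (θ : Form 1 W) (Ω : Form 2 W) : Prop :=
  ∀ w, θ ![w] = 0 → (∀ v, Ω ![w, v] = 0) → w = 0

theorem nondeg_of_wedge_ne_zero [FiniteDimensional ℝ W] {n : ℕ} {θ : Form 1 W} {Ω : Form 2 W}
    (hW : Module.finrank ℝ W = 2 * n + 1) (h : wedge θ (wedgePow Ω n) ≠ 0) : Nondeg θ Ω := by
  intro w hθ hΩ
  by_contra hw
  have hker : InKernel w (wedge θ (wedgePow Ω n)) :=
    (inKernel_one_iff.2 hθ).wedge ((inKernel_two_iff.2 hΩ).wedgePow n)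
  exact h (hker.eq_zero_of_finrank_eq hw (by omega))

theorem Nondeg.exists_reeb [FiniteDimensional ℝ W] {θ : Form 1 W} {Ω : Form 2 W}
    (h : Nondeg θ Ω) (hW : Odd (Module.finrank ℝ W)) :
    ∃ E, θ ![E] = 1 ∧ ∀ v, Ω ![E, v] = 0 := by
  let B : W →ₗ[ℝ] W →ₗ[ℝ] ℝ := ContinuousLinearMap.coeLM ℝ ∘ₗ Ω.flat
  have hB : B.IsAlt := fun w => (Ω.flat_apply w w).trans (Ω.apply_self w)
  obtain ⟨w, hw, hw0⟩ := Submodule.exists_mem_ne_zero_of_ne_bot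
    (ker_ne_bot_of_isAlt_of_odd_finrank hB hW)
  have hΩ : ∀ v, Ω ![w, v] = 0 := fun v =>
    (Ω.flat_apply w v).symm.trans (LinearMap.congr_fun (LinearMap.mem_ker.1 hw) v)
  have hθ : θ ![w] ≠ 0 := fun h0 => hw0 (h w h0 hΩ)
  refine ⟨(θ ![w])⁻¹ • w, ?_, fun v => by rw [Ω.smul_left, hΩ, mul_zero]⟩
  rw [← θ.covector_apply, map_smul, θ.covector_apply, smul_eq_mul, inv_mul_cancel₀ hθ]

variable [IsTopologicalAddGroup W] [ContinuousSMul ℝ W] [T2Space W] [FiniteDimensional ℝ W]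

theorem eq_of_forall_covector_apply_eq {u v : W} (h : ∀ α : W →L[ℝ] ℝ, α u = α v) : u = v :=
  sub_eq_zero.1 <| (Module.forall_dual_apply_eq_zero_iff ℝ _).1 fun f => by
    rw [map_sub, sub_eq_zero]; exact h (LinearMap.toContinuousLinearMap f)

/-- The morphism `w ↦ i(w)Ω + θ(w)θ` from vectors to covectors. Its inverse determines the Reeb
vector and the bivector associated to `(θ, Ω)`. -/
noncomputable def contactMap (θ : Form 1 W) (Ω : Form 2 W) : W →L[ℝ] W →L[ℝ] ℝ :=
  LinearMap.toContinuousLinearMap (Ω.flat + θ.covector.toLinearMap.smulRight θ.covector)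

theorem contactMap_apply (θ : Form 1 W) (Ω : Form 2 W) (w v : W) :
    contactMap θ Ω w v = Ω ![w, v] + θ ![w] * θ ![v] := by
  rw [← Ω.flat_apply, ← θ.covector_apply, ← θ.covector_apply]
  rfl

theorem Nondeg.isInvertible_contactMap {θ : Form 1 W} {Ω : Form 2 W} (h : Nondeg θ Ω) :
    (contactMap θ Ω).IsInvertible := by
  have hinj : Function.Injective (contactMap θ Ω) := by
    refine (injective_iff_map_eq_zero _).2 fun w hw => ?_
    have happly : ∀ v, Ω ![w, v] + θ ![w] * θ ![v] = 0 := fun v => by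
      rw [← contactMap_apply, hw]; rfl
    have hθ : θ ![w] = 0 := by simpa [Ω.apply_self] using happly w
    exact h w hθ fun v => by simpa [hθ] using happly v
  let D : (W →ₗ[ℝ] ℝ) ≃ₗ[ℝ] (W →L[ℝ] ℝ) := LinearMap.toContinuousLinearMap
  have : FiniteDimensional ℝ (W →L[ℝ] ℝ) := D.finiteDimensional
  have hrank : Module.finrank ℝ W = Module.finrank ℝ (W →L[ℝ] ℝ) :=
    Subspace.dual_finrank_eq.symm.trans D.finrank_eq
  exact ⟨(LinearMap.linearEquivOfInjective (contactMap θ Ω).toLinearMap hinj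
    hrank).toContinuousLinearEquiv, rfl⟩

/-- The Reeb vector `E` of `(θ, Ω)`. -/
noncomputable def reeb (θ : Form 1 W) (Ω : Form 2 W) : W := (contactMap θ Ω).inverse θ.covector

/-- The morphism `Λ^#` of the bivector associated to `(θ, Ω)`. -/
noncomputable def contactSharp (θ : Form 1 W) (Ω : Form 2 W) : (W →L[ℝ] ℝ) →L[ℝ] W :=
  (Form.covector (vec (reeb θ Ω))).smulRight (reeb θ Ω) - (contactMap θ Ω).inverse

theorem contactSharp_apply (θ : Form 1 W) (Ω : Form 2 W) (α : W →L[ℝ] ℝ) :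
    contactSharp θ Ω α = α (reeb θ Ω) • reeb θ Ω - (contactMap θ Ω).inverse α :=
  rfl

/-- The bivector `Λ` associated to `(θ, Ω)`: it is recovered from `Λ^#` by
`Λ(α, β) = Ω(Λ^#α, Λ^#β)`. -/
noncomputable def contactBivector (θ : Form 1 W) (Ω : Form 2 W) : MultiVec 2 W :=
  Ω.compContinuousLinearMap (contactSharp θ Ω)

theorem contactBivector_apply (θ : Form 1 W) (Ω : Form 2 W) (α β : W →L[ℝ] ℝ) :
    contactBivector θ Ω ![α, β] = Ω ![contactSharp θ Ω α, contactSharp θ Ω β] :=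
  Ω.eta_two _

end ContactMap

section AssociatedAt

variable {W : Type*} [AddCommGroup W] [Module ℝ W] [TopologicalSpace W]
  [IsTopologicalAddGroup W] [ContinuousSMul ℝ W] [T2Space W] [FiniteDimensional ℝ W]

/-- The pointwise form of `IsAssociatedPair`, with `Ω` in the role of `dϑ + ω`. -/
structure AssociatedAt (θ : Form 1 W) (Ω : Form 2 W) (L : MultiVec 2 W) (E : W) : Prop where
  reeb_one : θ ![E] = 1
  reeb_two : ∀ v, Ω ![E, v] = 0
  sharp_one : sharp L θ.covector = 0
  sharp_two : ∀ α v, Ω ![sharp L α, v] = -(α v - α E * θ ![v])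

namespace AssociatedAt

variable {θ : Form 1 W} {Ω : Form 2 W} {L : MultiVec 2 W} {E : W}

theorem theta_sharp (h : AssociatedAt θ Ω L E) (α : W →L[ℝ] ℝ) : θ ![sharp L α] = 0 := by
  rw [← θ.covector_apply, apply_sharp, Form.apply_swap, ← apply_sharp, h.sharp_one, map_zero,
    neg_zero]

theorem bivector_apply (h : AssociatedAt θ Ω L E) (α β : W →L[ℝ] ℝ) :
    L ![α, β] = Ω ![sharp L α, sharp L β] := by
  rw [h.sharp_two, h.theta_sharp, apply_sharp, Form.apply_swap L β α]
  ring

theorem nondeg (h : AssociatedAt θ Ω L E) : Nondeg θ Ω := by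
  intro w hθ hΩ
  refine eq_of_forall_covector_apply_eq fun α => ?_
  have hα := h.sharp_two α w
  rw [Ω.apply_swap, hΩ, hθ, mul_zero, sub_zero, neg_inj] at hα
  rw [← hα, map_zero]

theorem inverse_contactMap_apply (h : AssociatedAt θ Ω L E) (α : W →L[ℝ] ℝ) :
    (contactMap θ Ω).inverse α = α E • E - sharp L α := by
  have hmap : contactMap θ Ω (α E • E - sharp L α) = α := by
    ext v
    have hE : contactMap θ Ω E v = θ ![v] := by
      rw [contactMap_apply, h.reeb_two, h.reeb_one, zero_add, one_mul]
    have hL : contactMap θ Ω (sharp L α) v = -(α v - α E * θ ![v]) := by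
      rw [contactMap_apply, h.sharp_two, h.theta_sharp, zero_mul, add_zero]
    simp only [map_sub, map_smul, sub_apply, smul_apply, hE, hL, smul_eq_mul]
    ring
  conv_lhs => rw [← hmap, h.nondeg.isInvertible_contactMap.inverse_apply_self]

theorem eq_reeb (h : AssociatedAt θ Ω L E) : E = reeb θ Ω := by
  rw [reeb, h.inverse_contactMap_apply, h.sharp_one, θ.covector_apply, h.reeb_one, one_smul,
    sub_zero]

theorem sharp_eq_contactSharp (h : AssociatedAt θ Ω L E) : sharp L = contactSharp θ Ω := by
  ext1 α
  rw [contactSharp_apply, h.inverse_contactMap_apply, ← h.eq_reeb, sub_sub_cancel]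

theorem eq_contactBivector (h : AssociatedAt θ Ω L E) : L = contactBivector θ Ω :=
  Form.ext_two fun α β => by
    rw [h.bivector_apply, h.sharp_eq_contactSharp, contactBivector_apply]

end AssociatedAt

section Existence

variable {θ : Form 1 W} {Ω : Form 2 W}

theorem Nondeg.reeb_spec (h : Nondeg θ Ω) (hW : Odd (Module.finrank ℝ W)) :
    θ ![reeb θ Ω] = 1 ∧ ∀ v, Ω ![reeb θ Ω, v] = 0 := by
  obtain ⟨E, hθ, hΩ⟩ := h.exists_reeb hW
  have hE : contactMap θ Ω E = θ.covector := by
    ext v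
    rw [contactMap_apply, hΩ, hθ, zero_add, one_mul, θ.covector_apply]
  rw [reeb, ← hE, h.isInvertible_contactMap.inverse_apply_self]
  exact ⟨hθ, hΩ⟩

theorem Nondeg.theta_inverse_contactMap (h : Nondeg θ Ω) (hW : Odd (Module.finrank ℝ W))
    (α : W →L[ℝ] ℝ) : θ ![(contactMap θ Ω).inverse α] = α (reeb θ Ω) := by
  obtain ⟨hθ, hΩ⟩ := h.reeb_spec hW
  conv_rhs => rw [← h.isInvertible_contactMap.self_apply_inverse α]
  rw [contactMap_apply, Ω.apply_swap, hΩ, hθ, neg_zero, zero_add, mul_one]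

theorem Nondeg.theta_contactSharp (h : Nondeg θ Ω) (hW : Odd (Module.finrank ℝ W))
    (α : W →L[ℝ] ℝ) : θ ![contactSharp θ Ω α] = 0 := by
  rw [← θ.covector_apply, contactSharp_apply, map_sub, map_smul, θ.covector_apply,
    θ.covector_apply, (h.reeb_spec hW).1, h.theta_inverse_contactMap hW, smul_eq_mul, mul_one,
    sub_self]

theorem Nondeg.omega_contactSharp (h : Nondeg θ Ω) (hW : Odd (Module.finrank ℝ W))
    (α : W →L[ℝ] ℝ) (v : W) :
    Ω ![contactSharp θ Ω α, v] = -(α v - α (reeb θ Ω) * θ ![v]) := by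
  have hinv := congrArg (fun β : W →L[ℝ] ℝ => β v) (h.isInvertible_contactMap.self_apply_inverse α)
  simp only [contactMap_apply, h.theta_inverse_contactMap hW] at hinv
  rw [← Ω.flat_apply, contactSharp_apply, map_sub, map_smul, sub_apply, smul_apply, Ω.flat_apply,
    Ω.flat_apply, (h.reeb_spec hW).2, ← hinv]
  simp

theorem Nondeg.sharp_contactBivector (h : Nondeg θ Ω) (hW : Odd (Module.finrank ℝ W)) :
    sharp (contactBivector θ Ω) = contactSharp θ Ω := by
  ext1 α
  refine eq_of_forall_covector_apply_eq fun β => ?_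
  rw [apply_sharp, contactBivector_apply, Ω.apply_swap, h.omega_contactSharp hW,
    h.theta_contactSharp hW]
  ring

theorem Nondeg.associatedAt (h : Nondeg θ Ω) (hW : Odd (Module.finrank ℝ W)) :
    AssociatedAt θ Ω (contactBivector θ Ω) (reeb θ Ω) where
  reeb_one := (h.reeb_spec hW).1
  reeb_two := (h.reeb_spec hW).2
  sharp_one := by
    rw [h.sharp_contactBivector hW, contactSharp_apply, θ.covector_apply, (h.reeb_spec hW).1,
      one_smul, ← reeb, sub_self]
  sharp_two α v := by rw [h.sharp_contactBivector hW, h.omega_contactSharp hW]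

end Existence

variable {W' : Type*} [AddCommGroup W'] [Module ℝ W'] [TopologicalSpace W']
  [IsTopologicalAddGroup W'] [ContinuousSMul ℝ W'] [T2Space W'] [FiniteDimensional ℝ W']

theorem sharp_push (f : W →L[ℝ] W') (L : MultiVec 2 W) (α : W' →L[ℝ] ℝ) :
    sharp (push f L) α = f (sharp L (α.comp f)) :=
  eq_of_forall_covector_apply_eq fun β => by
    rw [apply_sharp, push_two_apply, ← ContinuousLinearMap.comp_apply, apply_sharp]

theorem AssociatedAt.map {θ : Form 1 W} {Ω : Form 2 W} {L : MultiVec 2 W} {E : W}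
    (h : AssociatedAt θ Ω L E) (e : W ≃L[ℝ] W') :
    AssociatedAt (θ.compContinuousLinearMap (e.symm : W' →L[ℝ] W))
      (Ω.compContinuousLinearMap (e.symm : W' →L[ℝ] W)) (push (e : W →L[ℝ] W') L) (e E) where
  reeb_one := by rw [Form.comp_apply_one]; simp [h.reeb_one]
  reeb_two v := by rw [Form.comp_apply_two]; simp [h.reeb_two]
  sharp_one := by
    have hθ : (Form.covector (θ.compContinuousLinearMap (e.symm : W' →L[ℝ] W))).comp
        (e : W →L[ℝ] W') = θ.covector := by
      ext w
      rw [ContinuousLinearMap.comp_apply, Form.covector_apply, Form.comp_apply_one]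
      simp [Form.covector_apply]
    rw [sharp_push, hθ, h.sharp_one, map_zero]
  sharp_two α v := by
    rw [Form.comp_apply_two, Form.comp_apply_one, sharp_push]
    simp [h.sharp_two]

end AssociatedAt

section Coordinates

variable {A : Type*} [NormedAddCommGroup A] [NormedSpace ℝ A] [FiniteDimensional ℝ A]

/-- The components of a `k`-form: its values on the `k`-tuples of vectors of a basis. They embed
the forms into a space of functions on a finite set. -/
noncomputable def Form.coords (k : ℕ) (A : Type*) [NormedAddCommGroup A] [NormedSpace ℝ A]
    [FiniteDimensional ℝ A] : Form k A →ₗ[ℝ] (Fin k → Fin (Module.finrank ℝ A)) → ℝ where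
  toFun η I := η fun i => Module.finBasis ℝ A (I i)
  map_add' _ _ := rfl
  map_smul' _ _ := rfl

theorem Form.coords_injective (k : ℕ) : Function.Injective (Form.coords k A) := by
  intro η ξ h
  exact ContinuousAlternatingMap.toAlternatingMap_injective
    ((Module.finBasis ℝ A).ext_alternating fun I _ => congrFun h I)

instance (k : ℕ) : FiniteDimensional ℝ (Form k A) :=
  Module.Finite.of_injective (Form.coords k A) (Form.coords_injective k)

theorem contDiffOn_form {V : Type*} [NormedAddCommGroup V] [NormedSpace ℝ V] {k : ℕ}
    {f : V → Form k A} {s : Set V} {r : WithTop ℕ∞}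
    (h : ∀ v, ContDiffOn ℝ r (fun y => f y v) s) : ContDiffOn ℝ r f s := by
  obtain ⟨K, hK⟩ := (Form.coords k A).exists_leftInverse_of_injective
    (LinearMap.ker_eq_bot.2 (Form.coords_injective k))
  have hcoords : ContDiffOn ℝ r (fun y => Form.coords k A (f y)) s :=
    contDiffOn_pi.2 fun I => h _
  have hf : f = fun y => LinearMap.toContinuousLinearMap K (Form.coords k A (f y)) :=
    funext fun y => (LinearMap.congr_fun hK (f y)).symm
  rw [hf]
  exact (ContinuousLinearMap.contDiff (F := Form k A)
    (LinearMap.toContinuousLinearMap K)).comp_contDiffOn hcoords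

end Coordinates

section Calculus

variable {V : Type*} [NormedAddCommGroup V] [NormedSpace ℝ V]

theorem differentiableAt_linearMap_comp {F G : Type*} [NormedAddCommGroup F] [NormedSpace ℝ F]
    [FiniteDimensional ℝ F] [NormedAddCommGroup G] [NormedSpace ℝ G] (S : F →ₗ[ℝ] G) {f : V → F}
    {y : V} (hf : DifferentiableAt ℝ f y) : DifferentiableAt ℝ (fun z => S (f z)) y :=
  (LinearMap.toContinuousLinearMap S).differentiableAt.comp y hf

theorem fderiv_linearMap_comp {F G : Type*} [NormedAddCommGroup F] [NormedSpace ℝ F]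
    [FiniteDimensional ℝ F] [NormedAddCommGroup G] [NormedSpace ℝ G] (S : F →ₗ[ℝ] G) {f : V → F}
    {y : V} (hf : DifferentiableAt ℝ f y) (u : V) :
    fderiv ℝ (fun z => S (f z)) y u = S (fderiv ℝ f y u) :=
  DFunLike.congr_fun
    ((LinearMap.toContinuousLinearMap S).hasFDerivAt.comp y hf.hasFDerivAt).fderiv u

section ProductRule

variable {A : Type*} [NormedAddCommGroup A] [NormedSpace ℝ A]

theorem fderiv_form_one {η : V → Form 1 A} {a : V → A} {y : V} (hη : DifferentiableAt ℝ η y)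
    (ha : DifferentiableAt ℝ a y) (u : V) :
    fderiv ℝ (fun z => η z ![a z]) y u = fderiv ℝ η y u ![a y] + η y ![fderiv ℝ a y u] := by
  have h := fderiv_continuousAlternatingMap_apply_apply (g := fun _ => a) hη (fun _ => ha) u
  have heta : ∀ z, (fun _ : Fin 1 => a z) = ![a z] := fun z => List.ofFn_inj.1 rfl
  rw [Fin.sum_univ_one, Form.eta_one (η y), Function.update_self] at h
  simpa only [heta] using h

theorem fderiv_form_two {η : V → Form 2 A} {a b : V → A} {y : V} (hη : DifferentiableAt ℝ η y)
    (ha : DifferentiableAt ℝ a y) (hb : DifferentiableAt ℝ b y) (u : V) :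
    fderiv ℝ (fun z => η z ![a z, b z]) y u =
      fderiv ℝ η y u ![a y, b y] + η y ![fderiv ℝ a y u, b y] + η y ![a y, fderiv ℝ b y u] := by
  have h := fderiv_continuousAlternatingMap_apply_apply (g := ![a, b]) hη
    (Fin.forall_fin_two.2 ⟨ha, hb⟩) u
  have heta : ∀ z, (fun i => (![a, b] : Fin 2 → V → A) i z) = ![a z, b z] := fun z =>
    List.ofFn_inj.1 rfl
  simp only [heta] at h
  rw [h, Fin.sum_univ_two, add_assoc]
  congr 3 <;> exact List.ofFn_inj.1 rfl

theorem extDeriv_one_apply (θ : A → Form 1 A) (y u v : A) :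
    extDeriv θ y ![u, v] = fderiv ℝ θ y u ![v] - fderiv ℝ θ y v ![u] := by
  rw [extDeriv, ContinuousAlternatingMap.alternatizeUncurryFin_apply, Fin.sum_univ_two]
  have h1 : Fin.removeNth 1 ![u, v] = ![u] := List.ofFn_inj.1 rfl
  simp [h1, sub_eq_add_neg]

theorem extDeriv_two_apply (Ω : A → Form 2 A) (y u v w : A) :
    extDeriv Ω y ![u, v, w] =
      fderiv ℝ Ω y u ![v, w] - fderiv ℝ Ω y v ![u, w] + fderiv ℝ Ω y w ![u, v] := by
  rw [extDeriv, ContinuousAlternatingMap.alternatizeUncurryFin_apply, Fin.sum_univ_three]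
  have h1 : Fin.removeNth 1 ![u, v, w] = ![u, w] := List.ofFn_inj.1 rfl
  have h2 : Fin.removeNth 2 ![u, v, w] = ![u, v] := List.ofFn_inj.1 rfl
  simp [h1, h2, sub_eq_add_neg]

theorem differentiableAt_extDeriv {k : ℕ} {θ : A → Form k A} {y : A}
    (hθ : ContDiffAt ℝ 2 θ y) : DifferentiableAt ℝ (extDeriv θ) y := by
  have hfderiv : DifferentiableAt ℝ (fderiv ℝ θ) y :=
    (hθ.fderiv_right (m := 1) (by norm_num)).differentiableAt (by norm_num)
  exact (ContinuousAlternatingMap.alternatizeUncurryFinCLM ℝ A ℝ).differentiableAt.comp y hfderiv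

theorem extDeriv_extDeriv_add {k : ℕ} {θ : A → Form k A} {ω : A → Form (k + 1) A} {y : A}
    (hθ : ContDiffAt ℝ 2 θ y) (hω : DifferentiableAt ℝ ω y) :
    extDeriv (fun z => extDeriv θ z + ω z) y = extDeriv ω y := by
  rw [extDeriv_fun_add (differentiableAt_extDeriv hθ) hω,
    extDeriv_extDeriv_apply hθ (by simp), zero_add]

end ProductRule

section Sharp

variable {A : Type*} [NormedAddCommGroup A] [NormedSpace ℝ A] [FiniteDimensional ℝ A]

/-- The linear map `P ↦ P^#(α)` on bivectors. -/
noncomputable def sharpₗ (α : A →L[ℝ] ℝ) : MultiVec 2 A →ₗ[ℝ] A where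
  toFun P := sharp P α
  map_add' P Q := eq_of_forall_covector_apply_eq fun β => by
    rw [map_add, apply_sharp, apply_sharp, apply_sharp]; rfl
  map_smul' c P := eq_of_forall_covector_apply_eq fun β => by
    rw [map_smul, apply_sharp, apply_sharp]; rfl

theorem differentiableAt_sharp {L : V → MultiVec 2 A} {y : V} (hL : DifferentiableAt ℝ L y)
    (α : A →L[ℝ] ℝ) : DifferentiableAt ℝ (fun z => sharp (L z) α) y :=
  differentiableAt_linearMap_comp (F := MultiVec 2 A) (sharpₗ α) hL

theorem fderiv_sharp {L : V → MultiVec 2 A} {y : V} (hL : DifferentiableAt ℝ L y)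
    (α : A →L[ℝ] ℝ) (u : V) :
    fderiv ℝ (fun z => sharp (L z) α) y u = sharp (fderiv ℝ L y u) α :=
  fderiv_linearMap_comp (F := MultiVec 2 A) (sharpₗ α) hL u

end Sharp

end Calculus

section AssociatedFields

open Topology

variable {V : Type*} [NormedAddCommGroup V] [NormedSpace ℝ V] [FiniteDimensional ℝ V]
  {θ : V → Form 1 V} {Ω ω : V → Form 2 V} {L : V → MultiVec 2 V} {E : V → V} {y : V}

theorem fderiv_theta_reeb (h : ∀ᶠ z in 𝓝 y, AssociatedAt (θ z) (Ω z) (L z) (E z))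
    (hθ : DifferentiableAt ℝ θ y) (hE : DifferentiableAt ℝ E y) (u : V) :
    θ y ![fderiv ℝ E y u] = -fderiv ℝ θ y u ![E y] := by
  have hconst : (fun z => θ z ![E z]) =ᶠ[𝓝 y] fun _ => 1 := h.mono fun z hz => hz.reeb_one
  have hderiv := fderiv_form_one hθ hE u
  rw [hconst.fderiv_eq, fderiv_fun_const] at hderiv
  exact eq_neg_of_add_eq_zero_right hderiv.symm

theorem fderiv_theta_sharp (h : ∀ᶠ z in 𝓝 y, AssociatedAt (θ z) (Ω z) (L z) (E z))
    (hθ : DifferentiableAt ℝ θ y) (hL : DifferentiableAt ℝ L y) (α : V →L[ℝ] ℝ) (u : V) :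
    θ y ![sharp (fderiv ℝ L y u) α] = -fderiv ℝ θ y u ![sharp (L y) α] := by
  have hconst : (fun z => θ z ![sharp (L z) α]) =ᶠ[𝓝 y] fun _ => 0 :=
    h.mono fun z hz => hz.theta_sharp α
  have hderiv := fderiv_form_one hθ (differentiableAt_sharp hL α) u
  rw [hconst.fderiv_eq, fderiv_fun_const, fderiv_sharp hL] at hderiv
  exact eq_neg_of_add_eq_zero_right hderiv.symm

theorem fderiv_omega_sharp_sharp (h : ∀ᶠ z in 𝓝 y, AssociatedAt (θ z) (Ω z) (L z) (E z))
    (hθ : DifferentiableAt ℝ θ y) (hΩ : DifferentiableAt ℝ Ω y) (hL : DifferentiableAt ℝ L y)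
    (β γ : V →L[ℝ] ℝ) (u : V) :
    fderiv ℝ Ω y u ![sharp (L y) β, sharp (L y) γ] =
      -fderiv ℝ L y u ![β, γ] + β (E y) * fderiv ℝ θ y u ![sharp (L y) γ]
        - γ (E y) * fderiv ℝ θ y u ![sharp (L y) β] := by
  have hbivector : (fun z => L z ![β, γ]) =ᶠ[𝓝 y] fun z => Ω z ![sharp (L z) β, sharp (L z) γ] :=
    h.mono fun z hz => hz.bivector_apply β γ
  have hderiv : fderiv ℝ L y u ![β, γ] = fderiv ℝ Ω y u ![sharp (L y) β, sharp (L y) γ]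
      + Ω y ![sharp (fderiv ℝ L y u) β, sharp (L y) γ]
      + Ω y ![sharp (L y) β, sharp (fderiv ℝ L y u) γ] := by
    rw [← fderiv_sharp hL, ← fderiv_sharp hL, ← fderiv_form_two hΩ (differentiableAt_sharp hL β)
      (differentiableAt_sharp hL γ), ← hbivector.fderiv_eq]
    exact (fderiv_continuousAlternatingMap_apply_const_apply hL _ _).symm
  have hpair : ∀ α β : V →L[ℝ] ℝ, Ω y ![sharp (L y) α, sharp (fderiv ℝ L y u) β] =
      fderiv ℝ L y u ![α, β] - α (E y) * fderiv ℝ θ y u ![sharp (L y) β] := fun α β => by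
    rw [h.self_of_nhds.sharp_two, apply_sharp, fderiv_theta_sharp h hθ hL, Form.apply_swap _ β α]
    ring
  rw [(Ω y).apply_swap _ (sharp (L y) γ), hpair, hpair, Form.apply_swap _ γ β] at hderiv
  linear_combination -hderiv

theorem fderiv_omega_sharp_reeb (h : ∀ᶠ z in 𝓝 y, AssociatedAt (θ z) (Ω z) (L z) (E z))
    (hθ : DifferentiableAt ℝ θ y) (hΩ : DifferentiableAt ℝ Ω y) (hL : DifferentiableAt ℝ L y)
    (hE : DifferentiableAt ℝ E y) (β : V →L[ℝ] ℝ) (u : V) :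
    fderiv ℝ Ω y u ![sharp (L y) β, E y] =
      β (fderiv ℝ E y u) + β (E y) * fderiv ℝ θ y u ![E y] := by
  have hzero : (fun z => Ω z ![sharp (L z) β, E z]) =ᶠ[𝓝 y] fun _ => 0 :=
    h.mono fun z hz => by dsimp only; rw [(Ω z).apply_swap, hz.reeb_two, neg_zero]
  have hderiv := fderiv_form_two hΩ (differentiableAt_sharp hL β) hE u
  rw [hzero.fderiv_eq, fderiv_fun_const, (Ω y).apply_swap _ (E y), h.self_of_nhds.reeb_two,
    h.self_of_nhds.sharp_two, fderiv_theta_reeb h hθ hE, Pi.zero_apply, zero_apply] at hderiv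
  linear_combination -hderiv

theorem cyclic_fderiv_bivector (h : ∀ᶠ z in 𝓝 y, AssociatedAt (θ z) (Ω z) (L z) (E z))
    (hθ : DifferentiableAt ℝ θ y) (hΩ : DifferentiableAt ℝ Ω y) (hL : DifferentiableAt ℝ L y)
    (α β γ : V →L[ℝ] ℝ) :
    fderiv ℝ L y (sharp (L y) α) ![β, γ] + fderiv ℝ L y (sharp (L y) β) ![γ, α]
        + fderiv ℝ L y (sharp (L y) γ) ![α, β] =
      -extDeriv Ω y ![sharp (L y) α, sharp (L y) β, sharp (L y) γ]
        - γ (E y) * extDeriv θ y ![sharp (L y) α, sharp (L y) β]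
        - α (E y) * extDeriv θ y ![sharp (L y) β, sharp (L y) γ]
        - β (E y) * extDeriv θ y ![sharp (L y) γ, sharp (L y) α] := by
  have hΩL := fderiv_omega_sharp_sharp h hθ hΩ hL
  simp only [extDeriv_one_apply, extDeriv_two_apply]
  rw [Form.apply_swap (fderiv ℝ Ω y (sharp (L y) β)), hΩL, hΩL, hΩL]
  ring

theorem lie_reeb_bivector (h : ∀ᶠ z in 𝓝 y, AssociatedAt (θ z) (Ω z) (L z) (E z))
    (hθ : DifferentiableAt ℝ θ y) (hΩ : DifferentiableAt ℝ Ω y) (hL : DifferentiableAt ℝ L y)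
    (hE : DifferentiableAt ℝ E y) (α β : V →L[ℝ] ℝ) :
    fderiv ℝ L y (E y) ![α, β] - β (fderiv ℝ E y (sharp (L y) α))
        + α (fderiv ℝ E y (sharp (L y) β)) =
      -extDeriv Ω y ![sharp (L y) α, sharp (L y) β, E y]
        + β (E y) * extDeriv θ y ![sharp (L y) α, E y]
        - α (E y) * extDeriv θ y ![sharp (L y) β, E y] := by
  have hΩE := fderiv_omega_sharp_reeb h hθ hΩ hL hE
  simp only [extDeriv_one_apply, extDeriv_two_apply]
  rw [fderiv_omega_sharp_sharp h hθ hΩ hL, hΩE, hΩE]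
  ring

theorem twisted_cyclic_identity
    (h : ∀ᶠ z in 𝓝 y, AssociatedAt (θ z) (extDeriv θ z + ω z) (L z) (E z))
    (hθ : ContDiffAt ℝ 2 θ y) (hω : DifferentiableAt ℝ ω y) (hL : DifferentiableAt ℝ L y)
    (α β γ : V →L[ℝ] ℝ) :
    fderiv ℝ L y (sharp (L y) α) ![β, γ] + fderiv ℝ L y (sharp (L y) β) ![γ, α]
        + fderiv ℝ L y (sharp (L y) γ) ![α, β]
        + (α (E y) * L y ![β, γ] + β (E y) * L y ![γ, α] + γ (E y) * L y ![α, β]) =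
      -extDeriv ω y ![sharp (L y) α, sharp (L y) β, sharp (L y) γ]
        + (γ (E y) * ω y ![sharp (L y) α, sharp (L y) β]
        + α (E y) * ω y ![sharp (L y) β, sharp (L y) γ]
        + β (E y) * ω y ![sharp (L y) γ, sharp (L y) α]) := by
  have hdθ := differentiableAt_extDeriv hθ
  rw [cyclic_fderiv_bivector h (hθ.differentiableAt (by norm_num)) (hdθ.add hω) hL,
    extDeriv_extDeriv_add hθ hω]
  simp only [h.self_of_nhds.bivector_apply, ContinuousAlternatingMap.add_apply]
  ring

theorem twisted_lie_identity
    (h : ∀ᶠ z in 𝓝 y, AssociatedAt (θ z) (extDeriv θ z + ω z) (L z) (E z))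
    (hθ : ContDiffAt ℝ 2 θ y) (hω : DifferentiableAt ℝ ω y) (hL : DifferentiableAt ℝ L y)
    (hE : DifferentiableAt ℝ E y) (α β : V →L[ℝ] ℝ) :
    fderiv ℝ L y (E y) ![α, β] - β (fderiv ℝ E y (sharp (L y) α))
        + α (fderiv ℝ E y (sharp (L y) β)) =
      -extDeriv ω y ![sharp (L y) α, sharp (L y) β, E y]
        - β (E y) * ω y ![sharp (L y) α, E y] + α (E y) * ω y ![sharp (L y) β, E y] := by
  have hdθ := differentiableAt_extDeriv hθ
  have hreeb : ∀ v, extDeriv θ y ![v, E y] = -ω y ![v, E y] := fun v => by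
    have := h.self_of_nhds.reeb_two v
    rw [Form.apply_swap, ContinuousAlternatingMap.add_apply] at this
    linarith
  rw [lie_reeb_bivector h (hθ.differentiableAt (by norm_num)) (hdθ.add hω) hL hE,
    extDeriv_extDeriv_add hθ hω, hreeb, hreeb]
  ring

end AssociatedFields

section SchoutenFlat

variable {V : Type*} [NormedAddCommGroup V] [NormedSpace ℝ V] [FiniteDimensional ℝ V]
  {A : Type*} [NormedAddCommGroup A] [NormedSpace ℝ A]

theorem sum_coord_mul_apply {k : ℕ} (D : V →L[ℝ] Form k A) (w : V) (v : Fin k → A) :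
    ∑ i, (Module.finBasis ℝ V).coord i w * D (Module.finBasis ℝ V i) v = D w v := by
  conv_rhs => rw [← (Module.finBasis ℝ V).sum_repr w]
  simp only [map_sum, map_smul, ContinuousAlternatingMap.sum_apply,
    ContinuousAlternatingMap.smul_apply, smul_eq_mul, Module.Basis.coord_apply]

/-- The multivector `∑ᵢ i(ρ*eⁱ)P ∧ D(eᵢ)`, for a basis `(eᵢ)` of `V`. With `D` the derivative of a
multivector field, the Schouten bracket is a difference of two terms of this kind. -/
noncomputable def contractWedge (ρ : A →L[ℝ] V) {p q : ℕ} (P : MultiVec (p + 1) A)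
    (D : V →L[ℝ] MultiVec q A) : MultiVec (p + q) A :=
  ∑ i, wedge (intProd ((LinearMap.toContinuousLinearMap ((Module.finBasis ℝ V).coord i)).comp ρ) P)
    (D (Module.finBasis ℝ V i))

theorem contractWedge_one_two_apply (ρ : A →L[ℝ] V) (P : MultiVec 1 A) (D : V →L[ℝ] MultiVec 2 A)
    {w : V} (hw : ∀ ε : V →L[ℝ] ℝ, P ![ε.comp ρ] = ε w) (ζ₁ ζ₂ : A →L[ℝ] ℝ) :
    (contractWedge (p := 0) ρ P D : MultiVec (0 + 2) A) ![ζ₁, ζ₂] = D w ![ζ₁, ζ₂] := by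
  rw [contractWedge, ContinuousAlternatingMap.sum_apply, ← sum_coord_mul_apply D w]
  refine Finset.sum_congr rfl fun i _ => (wedge_zero_two _ _ _ _).trans ?_
  exact congrArg (· * _) (hw _)

variable [FiniteDimensional ℝ A]

theorem intProd_bivector (P : MultiVec 2 A) (ε ζ : A →L[ℝ] ℝ) :
    intProd ε P ![ζ] = -ε (sharp P ζ) := by
  rw [apply_sharp, ← Form.apply_swap P ε ζ]
  rfl

theorem contractWedge_two_one_apply (ρ : A →L[ℝ] V) (P : MultiVec 2 A) (D : V →L[ℝ] MultiVec 1 A)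
    (ζ₁ ζ₂ : A →L[ℝ] ℝ) :
    (contractWedge (p := 1) ρ P D : MultiVec 2 A) ![ζ₁, ζ₂] =
      D (ρ (sharp P ζ₂)) ![ζ₁] - D (ρ (sharp P ζ₁)) ![ζ₂] := by
  rw [contractWedge, ContinuousAlternatingMap.sum_apply,
    ← sum_coord_mul_apply D (ρ (sharp P ζ₁)), ← sum_coord_mul_apply D (ρ (sharp P ζ₂)),
    ← Finset.sum_sub_distrib]
  refine Finset.sum_congr rfl fun i _ => (wedge_one_one _ _ _ _).trans ?_
  simp only [intProd_bivector, ContinuousLinearMap.comp_apply,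
    LinearMap.coe_toContinuousLinearMap']
  ring

theorem contractWedge_two_two_apply (ρ : A →L[ℝ] V) (P : MultiVec 2 A) (D : V →L[ℝ] MultiVec 2 A)
    (ζ₁ ζ₂ ζ₃ : A →L[ℝ] ℝ) :
    (contractWedge (p := 1) ρ P D : MultiVec 3 A) ![ζ₁, ζ₂, ζ₃] =
      -(D (ρ (sharp P ζ₁)) ![ζ₂, ζ₃] + D (ρ (sharp P ζ₂)) ![ζ₃, ζ₁]
        + D (ρ (sharp P ζ₃)) ![ζ₁, ζ₂]) := by
  rw [contractWedge, ContinuousAlternatingMap.sum_apply, ← sum_coord_mul_apply D (ρ (sharp P ζ₁)),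
    ← sum_coord_mul_apply D (ρ (sharp P ζ₂)), ← sum_coord_mul_apply D (ρ (sharp P ζ₃)),
    ← Finset.sum_add_distrib, ← Finset.sum_add_distrib, ← Finset.sum_neg_distrib]
  refine Finset.sum_congr rfl fun i _ => (wedge_one_two _ _ _ _ _).trans ?_
  simp only [intProd_bivector, ContinuousLinearMap.comp_apply,
    LinearMap.coe_toContinuousLinearMap']
  ring

theorem schoutenFlat_self_apply (ρ : A →L[ℝ] V) (P : V → MultiVec 2 A) (y : V)
    (ζ₁ ζ₂ ζ₃ : A →L[ℝ] ℝ) :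
    (schoutenFlat (p := 1) (q := 1) ρ P P y : MultiVec 3 A) ![ζ₁, ζ₂, ζ₃] =
      2 * (fderiv ℝ P y (ρ (sharp (P y) ζ₁)) ![ζ₂, ζ₃]
        + fderiv ℝ P y (ρ (sharp (P y) ζ₂)) ![ζ₃, ζ₁]
        + fderiv ℝ P y (ρ (sharp (P y) ζ₃)) ![ζ₁, ζ₂]) := by
  change (-1) ^ 1 * (contractWedge (p := 1) ρ (P y) (fderiv ℝ P y) : MultiVec 3 A) ![ζ₁, ζ₂, ζ₃]
    - (-1) ^ 2 * (contractWedge (p := 1) ρ (P y) (fderiv ℝ P y) : MultiVec 3 A) ![ζ₁, ζ₂, ζ₃] = _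
  rw [contractWedge_two_two_apply]
  ring

/-- The linear map `w ↦ vec w`. -/
noncomputable def vecₗ : A →ₗ[ℝ] MultiVec 1 A where
  toFun := vec
  map_add' u v := Form.ext_one fun α => map_add α u v
  map_smul' c v := Form.ext_one fun α => map_smul α c v

theorem fderiv_vec_apply {U : Type*} [NormedAddCommGroup U] [NormedSpace ℝ U] {E : U → A} {y : U}
    (hE : DifferentiableAt ℝ E y) (u : U) (α : A →L[ℝ] ℝ) :
    fderiv ℝ (fun z => vec (E z)) y u ![α] = α (fderiv ℝ E y u) :=
  DFunLike.congr_fun (fderiv_linearMap_comp (G := MultiVec 1 A) vecₗ hE u) ![α]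

theorem schoutenFlat_vec_apply {E : V → V} {L : V → MultiVec 2 V} {y : V}
    (hE : DifferentiableAt ℝ E y) (α β : V →L[ℝ] ℝ) :
    (schoutenFlat (p := 0) (q := 1) (ContinuousLinearMap.id ℝ V) (fun z => vec (E z)) L y :
        MultiVec 2 V) ![α, β] =
      fderiv ℝ L y (E y) ![α, β] - β (fderiv ℝ E y (sharp (L y) α))
        + α (fderiv ℝ E y (sharp (L y) β)) := by
  let ρ := ContinuousLinearMap.id ℝ V
  change (-1) ^ 0 * (contractWedge (p := 0) ρ (vec (E y)) (fderiv ℝ L y) :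
      MultiVec (0 + 2) V) ![α, β]
    - (-1) ^ 1 * (contractWedge (p := 1) ρ (L y) (fderiv ℝ (fun z => vec (E z)) y) :
      MultiVec 2 V) ![α, β] = _
  rw [contractWedge_one_two_apply ρ (vec (E y)) _ (w := E y) fun ε => rfl,
    contractWedge_two_one_apply, fderiv_vec_apply hE, fderiv_vec_apply hE]
  simp only [ρ, ContinuousLinearMap.id_apply]
  ring

end SchoutenFlat

section PairAt

variable {W : Type*} [AddCommGroup W] [Module ℝ W] [TopologicalSpace W]

theorem covector_prod_apply (ζ : W × ℝ →L[ℝ] ℝ) (w : W) (c : ℝ) :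
    ζ (w, c) = ζ.comp (ContinuousLinearMap.inl ℝ W ℝ) w + c * ζ (0, 1) := by
  have hsplit : ((w, c) : W × ℝ) = ContinuousLinearMap.inl ℝ W ℝ w + c • ((0, 1) : W × ℝ) := by
    ext <;> simp
  rw [hsplit, map_add, map_smul]
  rfl

variable [ContinuousSMul ℝ W]

/-- The pointwise form of `pair`. -/
noncomputable def pairAt (P : MultiVec 2 W) (E : W) : MultiVec 2 (W × ℝ) :=
  push (ContinuousLinearMap.inl ℝ W ℝ) P
    + wedge (vec ((0, 1) : W × ℝ)) (vec ((E, 0) : W × ℝ))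

theorem pairAt_apply (P : MultiVec 2 W) (E : W) (ζ ξ : W × ℝ →L[ℝ] ℝ) :
    pairAt P E ![ζ, ξ] =
      P ![ζ.comp (ContinuousLinearMap.inl ℝ W ℝ), ξ.comp (ContinuousLinearMap.inl ℝ W ℝ)]
        + (ζ (0, 1) * ξ.comp (ContinuousLinearMap.inl ℝ W ℝ) E
          - ξ (0, 1) * ζ.comp (ContinuousLinearMap.inl ℝ W ℝ) E) := by
  rw [pairAt, ContinuousAlternatingMap.add_apply, push_two_apply]
  exact congrArg _ (wedge_one_one _ _ ζ ξ)

theorem intProd_snd_pairAt (P : MultiVec 2 W) (E : W) (ξ : W × ℝ →L[ℝ] ℝ) :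
    intProd (ContinuousLinearMap.snd ℝ W ℝ) (pairAt P E) ![ξ] =
      ξ.comp (ContinuousLinearMap.inl ℝ W ℝ) E := by
  refine (pairAt_apply P E _ ξ).trans ?_
  have hsnd : (ContinuousLinearMap.snd ℝ W ℝ).comp (ContinuousLinearMap.inl ℝ W ℝ) = 0 := by
    ext; simp
  have hzero : ∀ α, P ![0, α] = 0 := fun α => P.map_coord_zero 0 rfl
  rw [hsnd, hzero]
  simp

theorem push_pairAt {W' : Type*} [AddCommGroup W'] [Module ℝ W'] [TopologicalSpace W']
    [ContinuousSMul ℝ W'] (f : W →L[ℝ] W') (P : MultiVec 2 W) (E : W) :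
    push (f.prodMap (ContinuousLinearMap.id ℝ ℝ)) (pairAt P E) = pairAt (push f P) (f E) := by
  have hinl (ζ : W' × ℝ →L[ℝ] ℝ) : (ζ.comp (f.prodMap (ContinuousLinearMap.id ℝ ℝ))).comp
      (ContinuousLinearMap.inl ℝ W ℝ) = (ζ.comp (ContinuousLinearMap.inl ℝ W' ℝ)).comp f := by
    ext w; simp
  have hone (ζ : W' × ℝ →L[ℝ] ℝ) :
      ζ.comp (f.prodMap (ContinuousLinearMap.id ℝ ℝ)) (0, 1) = ζ (0, 1) := by
    simp
  refine Form.ext_two fun ζ ξ => ?_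
  rw [push_two_apply, pairAt_apply, pairAt_apply, push_two_apply, hinl, hinl, hone, hone]
  rfl

theorem sharp_pairAt [IsTopologicalAddGroup W] [T2Space W] [FiniteDimensional ℝ W]
    (P : MultiVec 2 W) (E : W) (ζ : W × ℝ →L[ℝ] ℝ) :
    sharp (pairAt P E) ζ =
      (sharp P (ζ.comp (ContinuousLinearMap.inl ℝ W ℝ)) + ζ (0, 1) • E,
        -ζ.comp (ContinuousLinearMap.inl ℝ W ℝ) E) :=
  eq_of_forall_covector_apply_eq fun ξ => by
    rw [apply_sharp, pairAt_apply, covector_prod_apply ξ (_ + _), map_add, map_smul, apply_sharp,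
      smul_eq_mul]
    ring

/-- The linear map `(P, E) ↦ pairAt P E`. -/
noncomputable def pairₗ : MultiVec 2 W × W →ₗ[ℝ] MultiVec 2 (W × ℝ) where
  toFun q := pairAt q.1 q.2
  map_add' q r := Form.ext_two fun ζ ξ => by
    simp only [pairAt_apply, map_add, Prod.fst_add, Prod.snd_add,
      ContinuousAlternatingMap.add_apply]
    ring
  map_smul' c q := Form.ext_two fun ζ ξ => by
    simp only [pairAt_apply, map_smul, Prod.smul_fst, Prod.smul_snd,
      ContinuousAlternatingMap.smul_apply, smul_eq_mul, RingHom.id_apply]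
    ring

theorem fderiv_pairAt {V A : Type*} [NormedAddCommGroup V] [NormedSpace ℝ V]
    [NormedAddCommGroup A] [NormedSpace ℝ A] [FiniteDimensional ℝ A] {L : V → MultiVec 2 A}
    {E : V → A} {y : V} (hL : DifferentiableAt ℝ L y) (hE : DifferentiableAt ℝ E y) (u : V) :
    fderiv ℝ (fun z => pairAt (L z) (E z)) y u = pairAt (fderiv ℝ L y u) (fderiv ℝ E y u) := by
  refine (fderiv_linearMap_comp (F := MultiVec 2 A × A) (G := MultiVec 2 (A × ℝ)) pairₗ
    (hL.prodMk hE) u).trans ?_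
  rw [hL.fderiv_prodMk hE]
  rfl

end PairAt

section PairForm

variable {W : Type*} [AddCommGroup W] [Module ℝ W] [TopologicalSpace W]

theorem Form.apply_cycle (η : Form 3 W) (u v w : W) : η ![u, v, w] = η ![v, w, u] := by
  have hperm := η.toAlternatingMap.map_perm ![u, v, w] (finRotate 3)
  have hsign : Equiv.Perm.sign (finRotate 3) = 1 := by decide
  rw [hsign, _root_.one_smul] at hperm
  exact hperm.symm.trans (η.eta_three _)

theorem Form.apply_add_smul (η : Form 3 W) (a b c e : W) (f g h : ℝ) :
    η ![a + f • e, b + g • e, c + h • e] =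
      η ![a, b, c] + f * η ![b, c, e] + g * η ![c, a, e] + h * η ![a, b, e] := by
  have hleft : ∀ v w, η ![a + f • e, v, w] = η ![a, v, w] + f * η ![e, v, w] := fun v w =>
    (η.vecCons_add ![v, w] a (f • e)).trans
      (congrArg (η ![a, v, w] + ·) (η.vecCons_smul ![v, w] f e))
  have hcurry : ∀ u v w, η ![u, v, w] = intProd u η ![v, w] := fun _ _ _ => rfl
  have hself : ∀ v, η ![e, e, v] = 0 := fun v =>
    η.map_eq_zero_of_eq ![e, e, v] (i := 0) (j := 1) rfl (by decide)
  rw [hleft, hcurry a, hcurry e]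
  simp only [Form.add_left, Form.add_right, Form.smul_left, Form.smul_right, Form.apply_self]
  rw [(intProd a η).apply_swap e c, (intProd e η).apply_swap b e]
  simp only [← hcurry, hself]
  rw [η.apply_cycle e b c, η.apply_cycle c a e, hcurry a e c, (intProd a η).apply_swap e c,
    ← hcurry]
  ring

/-- The pointwise form of `pairForm`. -/
noncomputable def pairFormAt (η : Form 3 W) (ξ : Form 2 W) : Form 3 (W × ℝ) :=
  η.compContinuousLinearMap (ContinuousLinearMap.fst ℝ W ℝ)
    + wedge (p := 1) (q := 2)
        (ContinuousAlternatingMap.ofSubsingleton ℝ (W × ℝ) ℝ (0 : Fin 1)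
          (ContinuousLinearMap.snd ℝ W ℝ))
        (ξ.compContinuousLinearMap (ContinuousLinearMap.fst ℝ W ℝ))

theorem pairFormAt_apply (η : Form 3 W) (ξ : Form 2 W) (u v w : W × ℝ) :
    pairFormAt η ξ ![u, v, w] = η ![u.1, v.1, w.1] +
      (u.2 * ξ ![v.1, w.1] + v.2 * ξ ![w.1, u.1] + w.2 * ξ ![u.1, v.1]) := by
  rw [pairFormAt, ContinuousAlternatingMap.add_apply, Form.comp_apply_three]
  refine congrArg _ ((wedge_one_two _ _ u v w).trans ?_)
  simp only [Form.comp_apply_two]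
  rfl

end PairForm

section SharpForm

variable {W : Type*} [AddCommGroup W] [Module ℝ W] [TopologicalSpace W]
  (S : (W →L[ℝ] ℝ) →L[ℝ] W) (w : W) (α β γ : W →L[ℝ] ℝ)

theorem sharpForm_two_apply (η : Form 2 W) : sharpForm S η ![α, β] = η ![S α, S β] := by
  rw [sharpForm, ContinuousAlternatingMap.smul_apply, Form.comp_apply_two, neg_one_sq, one_smul]

theorem sharpForm_three_apply (η : Form 3 W) :
    sharpForm S η ![α, β, γ] = -η ![S α, S β, S γ] := by
  rw [sharpForm, ContinuousAlternatingMap.smul_apply, Form.comp_apply_three, smul_eq_mul]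
  ring

theorem sharpTensorOne_two_apply (η : Form 2 W) : sharpTensorOne S η w ![α] = η ![S α, w] := by
  rw [sharpTensorOne, ContinuousAlternatingMap.smul_apply, Form.comp_apply_one, intProdLast_apply,
    Form.eta_two, smul_eq_mul]
  exact (congrArg (· * _) neg_one_sq).trans (one_mul _)

theorem sharpTensorOne_three_apply (η : Form 3 W) :
    sharpTensorOne S η w ![α, β] = -η ![S α, S β, w] := by
  rw [sharpTensorOne, ContinuousAlternatingMap.smul_apply, Form.comp_apply_two, intProdLast_apply,
    Form.eta_three, smul_eq_mul]
  change (-1) ^ 3 * η ![S α, S β, w] = _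
  ring

end SharpForm

section FlatEquations

open Topology

variable {V : Type*} [NormedAddCommGroup V] [NormedSpace ℝ V] [FiniteDimensional ℝ V]
  {θ : V → Form 1 V} {ω : V → Form 2 V} {L : V → MultiVec 2 V} {E : V → V} {y : V}

theorem flat_twistedJacobiEq₁
    (h : ∀ᶠ z in 𝓝 y, AssociatedAt (θ z) (extDeriv θ z + ω z) (L z) (E z))
    (hθ : ContDiffAt ℝ 2 θ y) (hω : DifferentiableAt ℝ ω y) (hL : DifferentiableAt ℝ L y) :
    (schoutenFlat (p := 1) (q := 1) (ContinuousLinearMap.id ℝ V) L L y : MultiVec 3 V)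
        + (2 : ℝ) • (wedge (vec (E y)) (L y) : MultiVec 3 V) =
      (2 : ℝ) • (sharpForm (sharp (L y)) (extDeriv ω y) : MultiVec 3 V)
        + (2 : ℝ) • (wedge (sharpForm (sharp (L y)) (ω y)) (vec (E y)) : MultiVec 3 V) := by
  refine Form.ext_three fun α β γ => ?_
  have hschouten := schoutenFlat_self_apply (ContinuousLinearMap.id ℝ V) L y α β γ
  have hleft := wedge_one_two (vec (E y)) (L y) α β γ
  have hright := wedge_two_one (sharpForm (sharp (L y)) (ω y)) (vec (E y)) α β γ
  simp only [sharpForm_two_apply, vec_apply, Matrix.cons_val_zero,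
    ContinuousLinearMap.id_apply] at hschouten hleft hright
  simp only [ContinuousAlternatingMap.add_apply, ContinuousAlternatingMap.smul_apply,
    sharpForm_three_apply, smul_eq_mul]
  refine (congrArg₂ (fun s t => s + 2 * t) hschouten hleft).trans
    (Eq.trans ?_ (congrArg (fun t => 2 * -extDeriv ω y _ + 2 * t) hright.symm))
  linear_combination 2 * twisted_cyclic_identity h hθ hω hL α β γ

theorem flat_twistedJacobiEq₂
    (h : ∀ᶠ z in 𝓝 y, AssociatedAt (θ z) (extDeriv θ z + ω z) (L z) (E z))
    (hθ : ContDiffAt ℝ 2 θ y) (hω : DifferentiableAt ℝ ω y) (hL : DifferentiableAt ℝ L y)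
    (hE : DifferentiableAt ℝ E y) :
    (schoutenFlat (p := 0) (q := 1) (ContinuousLinearMap.id ℝ V) (fun z => vec (E z)) L y :
        MultiVec 2 V) =
      (sharpTensorOne (sharp (L y)) (extDeriv ω y) (E y) : MultiVec 2 V)
        - (wedge (sharpTensorOne (sharp (L y)) (ω y) (E y)) (vec (E y)) : MultiVec 2 V) := by
  refine Form.ext_two fun α β => ?_
  have hwedge := wedge_one_one (sharpTensorOne (sharp (L y)) (ω y) (E y)) (vec (E y)) α β
  simp only [sharpTensorOne_two_apply, vec_apply, Matrix.cons_val_zero] at hwedge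
  rw [schoutenFlat_vec_apply hE, twisted_lie_identity h hθ hω hL hE,
    ContinuousAlternatingMap.sub_apply, sharpTensorOne_three_apply]
  refine Eq.trans ?_ (congrArg (fun t => -extDeriv ω y _ - t) hwedge.symm)
  ring

-- The component of the equation along three covectors `(αᵢ, fᵢ)` is the cyclic identity for the
-- `αᵢ` plus `fᵢ` times the Lie derivative identity for the other two.
theorem flat_isTwistedJacobi_equation
    (h : ∀ᶠ z in 𝓝 y, AssociatedAt (θ z) (extDeriv θ z + ω z) (L z) (E z))
    (hθ : ContDiffAt ℝ 2 θ y) (hω : DifferentiableAt ℝ ω y) (hL : DifferentiableAt ℝ L y)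
    (hE : DifferentiableAt ℝ E y) :
    (2⁻¹ : ℝ) • ((schoutenFlat (p := 1) (q := 1) (ContinuousLinearMap.fst ℝ V ℝ)
          (fun z => pairAt (L z) (E z)) (fun z => pairAt (L z) (E z)) y : MultiVec 3 (V × ℝ))
        + (wedge (pairAt (L y) (E y))
            (intProd (ContinuousLinearMap.snd ℝ V ℝ) (pairAt (L y) (E y))) :
          MultiVec 3 (V × ℝ))
        + (wedge (intProd (ContinuousLinearMap.snd ℝ V ℝ) (pairAt (L y) (E y)))
            (pairAt (L y) (E y)) : MultiVec 3 (V × ℝ))) =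
      sharpForm (sharp (pairAt (L y) (E y))) (pairFormAt (extDeriv ω y) (ω y)) := by
  refine Form.ext_three fun ζ₁ ζ₂ ζ₃ => ?_
  set P := pairAt (L y) (E y) with hP
  have hright : (wedge P (intProd (ContinuousLinearMap.snd ℝ V ℝ) P) : MultiVec 3 (V × ℝ))
      ![ζ₁, ζ₂, ζ₃] = _ := wedge_two_one _ _ ζ₁ ζ₂ ζ₃
  have hleft : (wedge (intProd (ContinuousLinearMap.snd ℝ V ℝ) P) P : MultiVec 3 (V × ℝ))
      ![ζ₁, ζ₂, ζ₃] = _ := wedge_one_two _ _ ζ₁ ζ₂ ζ₃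
  simp only [ContinuousAlternatingMap.add_apply, ContinuousAlternatingMap.smul_apply,
    smul_eq_mul]
  rw [hright, hleft, schoutenFlat_self_apply, sharpForm_three_apply, pairFormAt_apply]
  simp only [hP, sharp_pairAt, ContinuousLinearMap.coe_fst', intProd_snd_pairAt,
    fderiv_pairAt hL hE, pairAt_apply, Form.apply_add_smul, map_add, map_smul,
    Form.add_left, Form.add_right, Form.smul_left, Form.smul_right, Form.apply_self,
    ContinuousAlternatingMap.add_apply, ContinuousAlternatingMap.smul_apply, smul_eq_mul]
  generalize ζ₁.comp (ContinuousLinearMap.inl ℝ V ℝ) = α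
  generalize ζ₂.comp (ContinuousLinearMap.inl ℝ V ℝ) = β
  generalize ζ₃.comp (ContinuousLinearMap.inl ℝ V ℝ) = γ
  have hcyclic := twisted_cyclic_identity h hθ hω hL α β γ
  have hlie := twisted_lie_identity h hθ hω hL hE
  rw [(ω y).apply_swap (E y), (ω y).apply_swap (E y), (ω y).apply_swap (E y)]
  linear_combination hcyclic + ζ₁ (0, 1) * hlie β γ + ζ₂ (0, 1) * hlie γ α + ζ₃ (0, 1) * hlie α β

end FlatEquations

section FlatSmoothness

variable {V : Type*} [NormedAddCommGroup V] [NormedSpace ℝ V]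

theorem contDiffOn_extDeriv {k : ℕ} {η : V → Form k V} {s : Set V} (hs : IsOpen s)
    (hη : ContDiffOn ℝ (⊤ : ℕ∞) η s) : ContDiffOn ℝ (⊤ : ℕ∞) (extDeriv η) s :=
  (ContinuousAlternatingMap.alternatizeUncurryFinCLM ℝ V ℝ).contDiff.comp_contDiffOn
    (hη.fderiv_of_isOpen hs (by simp))

variable [FiniteDimensional ℝ V] {r : WithTop ℕ∞} {θ : V → Form 1 V} {Ω : V → Form 2 V}
  {L : V → MultiVec 2 V} {E : V → V} {s : Set V}

theorem contDiffOn_covector (hθ : ContDiffOn ℝ r θ s) :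
    ContDiffOn ℝ r (fun y => (θ y).covector) s := by
  refine contDiffOn_clm_apply.2 fun v => ?_
  simp only [Form.covector_apply]
  exact (ContinuousAlternatingMap.apply ℝ V ℝ ![v]).contDiff.comp_contDiffOn hθ

theorem contDiffOn_contactMap (hθ : ContDiffOn ℝ r θ s) (hΩ : ContDiffOn ℝ r Ω s) :
    ContDiffOn ℝ r (fun y => contactMap (θ y) (Ω y)) s := by
  have hθ' : ∀ v, ContDiffOn ℝ r (fun y => θ y ![v]) s := fun v =>
    (ContinuousAlternatingMap.apply ℝ V ℝ ![v]).contDiff.comp_contDiffOn hθ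
  have hΩ' : ∀ u v, ContDiffOn ℝ r (fun y => Ω y ![u, v]) s := fun u v =>
    (ContinuousAlternatingMap.apply ℝ V ℝ ![u, v]).contDiff.comp_contDiffOn hΩ
  refine contDiffOn_clm_apply.2 fun u => contDiffOn_clm_apply.2 fun v => ?_
  simp only [contactMap_apply]
  exact (hΩ' u v).add ((hθ' u).mul (hθ' v))

theorem contDiffOn_inverse_contactMap (hθ : ContDiffOn ℝ r θ s) (hΩ : ContDiffOn ℝ r Ω s)
    (h : ∀ y ∈ s, Nondeg (θ y) (Ω y)) :
    ContDiffOn ℝ r (fun y => (contactMap (θ y) (Ω y)).inverse) s := by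
  intro y hy
  obtain ⟨e, he⟩ := (h y hy).isInvertible_contactMap
  have hinv : ContDiffAt ℝ r ContinuousLinearMap.inverse (contactMap (θ y) (Ω y)) :=
    he ▸ contDiffAt_map_inverse e
  exact hinv.comp_contDiffWithinAt y (contDiffOn_contactMap hθ hΩ y hy)

theorem contDiffOn_reeb (hθ : ContDiffOn ℝ r θ s) (hΩ : ContDiffOn ℝ r Ω s)
    (h : ∀ y ∈ s, AssociatedAt (θ y) (Ω y) (L y) (E y)) : ContDiffOn ℝ r E s :=
  ((contDiffOn_inverse_contactMap hθ hΩ fun y hy => (h y hy).nondeg).clm_apply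
    (contDiffOn_covector hθ)).congr fun y hy => (h y hy).eq_reeb

theorem contDiffOn_bivector (hθ : ContDiffOn ℝ r θ s) (hΩ : ContDiffOn ℝ r Ω s)
    (h : ∀ y ∈ s, AssociatedAt (θ y) (Ω y) (L y) (E y)) : ContDiffOn ℝ r L s := by
  have hE := contDiffOn_reeb hθ hΩ h
  have hinv := contDiffOn_inverse_contactMap hθ hΩ fun y hy => (h y hy).nondeg
  have hL : ∀ α β : V →L[ℝ] ℝ, ∀ y ∈ s,
      L y ![α, β] = α (E y) * β (E y) - β ((contactMap (θ y) (Ω y)).inverse α) :=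
    fun α β y hy => by
      rw [(h y hy).inverse_contactMap_apply, map_sub, map_smul, apply_sharp, smul_eq_mul,
        sub_sub_cancel]
  refine contDiffOn_form fun ζ => ?_
  simp only [Form.eta_two _ ζ]
  exact ((((ζ 0).contDiff.comp_contDiffOn hE).mul ((ζ 1).contDiff.comp_contDiffOn hE)).sub
    ((ζ 1).contDiff.comp_contDiffOn (hinv.clm_apply contDiffOn_const))).congr (hL _ _)

end FlatSmoothness

section Charts

open Topology

variable {V : Type*} [NormedAddCommGroup V] [NormedSpace ℝ V]
  {M : Type*} [TopologicalSpace M] [ChartedSpace V M]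

theorem formInChart_apply {k : ℕ} (η : DiffForm V M k) {x₀ x : M}
    (hx : x ∈ (extChartAt 𝓘(ℝ, V) x₀).source) :
    formInChart η x₀ (extChartAt 𝓘(ℝ, V) x₀ x) =
      (η x).compContinuousLinearMap (dChartInv V x₀ x) :=
  congrArg (fun w => (η w).compContinuousLinearMap (dChartInv V x₀ w))
    ((extChartAt 𝓘(ℝ, V) x₀).left_inv hx)

theorem SmoothForm.contDiffAt_inChart {k : ℕ} {η : DiffForm V M k} (hη : SmoothForm η) (x : M) :
    ContDiffAt ℝ (⊤ : ℕ∞) (formInChart η x) (extChartAt 𝓘(ℝ, V) x x) :=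
  (hη x).contDiffAt (extChartAt_target_mem_nhds x)

theorem SmoothForm.contDiffAt_two_inChart {k : ℕ} {η : DiffForm V M k} (hη : SmoothForm η) (x : M) :
    ContDiffAt ℝ 2 (formInChart η x) (extChartAt 𝓘(ℝ, V) x x) :=
  (hη.contDiffAt_inChart x).of_le (WithTop.coe_le_coe.2 le_top)

theorem SmoothForm.differentiableAt_inChart {k : ℕ} {η : DiffForm V M k} (hη : SmoothForm η)
    (x : M) : DifferentiableAt ℝ (formInChart η x) (extChartAt 𝓘(ℝ, V) x x) :=
  (hη.contDiffAt_inChart x).differentiableAt (by simp)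

theorem eventually_mem_target_and_symm_mem_source {x₀ x₁ : M} {y : V}
    (hy : y ∈ (extChartAt 𝓘(ℝ, V) x₀).target)
    (hx₁ : (extChartAt 𝓘(ℝ, V) x₀).symm y ∈ (extChartAt 𝓘(ℝ, V) x₁).source) :
    ∀ᶠ z in 𝓝 y, z ∈ (extChartAt 𝓘(ℝ, V) x₀).target ∧
      (extChartAt 𝓘(ℝ, V) x₀).symm z ∈ (extChartAt 𝓘(ℝ, V) x₁).source :=
  have htarget := (isOpen_extChartAt_target (I := 𝓘(ℝ, V)) x₀).mem_nhds hy
  Filter.Eventually.and htarget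
    (((continuousOn_extChartAt_symm x₀).continuousAt htarget).preimage_mem_nhds
      ((isOpen_extChartAt_source x₁).mem_nhds hx₁))

variable [IsManifold 𝓘(ℝ, V) (⊤ : ℕ∞) M]

theorem dChart_isInvertible {x₀ x : M} (hx : x ∈ (extChartAt 𝓘(ℝ, V) x₀).source) :
    (dChart V x₀ x).IsInvertible :=
  isInvertible_mfderiv_extChartAt hx

theorem dChartInv_dChart {x₀ x : M} (hx : x ∈ (extChartAt 𝓘(ℝ, V) x₀).source) (w : T V x) :
    dChartInv V x₀ x (dChart V x₀ x w) = w :=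
  (dChart_isInvertible hx).inverse_apply_self w

theorem dChart_self (x : M) : dChart V x x = ContinuousLinearMap.id ℝ V :=
  mfderiv_extChartAt_self

theorem dChartInv_self (x : M) : dChartInv V x x = ContinuousLinearMap.id ℝ V :=
  (congrArg ContinuousLinearMap.inverse (dChart_self x)).trans ContinuousLinearMap.inverse_id

theorem contDiffAt_transition {x₀ x₁ : M} {y : V} (hy : y ∈ (extChartAt 𝓘(ℝ, V) x₀).target)
    (hx₁ : (extChartAt 𝓘(ℝ, V) x₀).symm y ∈ (extChartAt 𝓘(ℝ, V) x₁).source) :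
    ContDiffAt ℝ (⊤ : ℕ∞) (extChartAt 𝓘(ℝ, V) x₁ ∘ (extChartAt 𝓘(ℝ, V) x₀).symm) y := by
  have hmem : y ∈ ((extChartAt 𝓘(ℝ, V) x₀).symm ≫ extChartAt 𝓘(ℝ, V) x₁).source := by
    rw [PartialEquiv.trans_source]
    exact ⟨hy, hx₁⟩
  have hwithin := contDiffWithinAt_ext_coord_change (I := 𝓘(ℝ, V)) (n := (⊤ : ℕ∞)) x₁ x₀ hmem
  rwa [ModelWithCorners.range_eq_univ, contDiffWithinAt_univ] at hwithin

theorem dChartInv_eq_mfderiv_symm {x₀ : M} {y : V} (hy : y ∈ (extChartAt 𝓘(ℝ, V) x₀).target) :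
    dChartInv V x₀ ((extChartAt 𝓘(ℝ, V) x₀).symm y) =
      mfderiv 𝓘(ℝ, V) 𝓘(ℝ, V) (extChartAt 𝓘(ℝ, V) x₀).symm y := by
  have hright := mfderiv_extChartAt_comp_mfderivWithin_extChartAt_symm hy
  have hleft := mfderivWithin_extChartAt_symm_comp_mfderiv_extChartAt hy
  rw [ModelWithCorners.range_eq_univ, mfderivWithin_univ] at hright hleft
  exact ContinuousLinearMap.inverse_eq hright hleft

theorem fderiv_transition {x₀ x₁ : M} {y : V} (hy : y ∈ (extChartAt 𝓘(ℝ, V) x₀).target)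
    (hx₁ : (extChartAt 𝓘(ℝ, V) x₀).symm y ∈ (extChartAt 𝓘(ℝ, V) x₁).source) :
    fderiv ℝ (extChartAt 𝓘(ℝ, V) x₁ ∘ (extChartAt 𝓘(ℝ, V) x₀).symm) y =
      (dChart V x₁ ((extChartAt 𝓘(ℝ, V) x₀).symm y)).comp
        (dChartInv V x₀ ((extChartAt 𝓘(ℝ, V) x₀).symm y)) := by
  have hsymm : MDifferentiableAt 𝓘(ℝ, V) 𝓘(ℝ, V) (extChartAt 𝓘(ℝ, V) x₀).symm y := by
    have := mdifferentiableWithinAt_extChartAt_symm hy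
    rwa [ModelWithCorners.range_eq_univ, mdifferentiableWithinAt_univ] at this
  have hchart : MDifferentiableAt 𝓘(ℝ, V) 𝓘(ℝ, V) (extChartAt 𝓘(ℝ, V) x₁)
      ((extChartAt 𝓘(ℝ, V) x₀).symm y) :=
    mdifferentiableAt_extChartAt (by rwa [extChartAt_source] at hx₁)
  rw [← mfderiv_eq_fderiv, mfderiv_comp y hchart hsymm, dChartInv_eq_mfderiv_symm hy]
  rfl

theorem formInChart_eventuallyEq_transition {k : ℕ} (η : DiffForm V M k) {x₀ x₁ : M} {y : V}
    (hy : y ∈ (extChartAt 𝓘(ℝ, V) x₀).target)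
    (hx₁ : (extChartAt 𝓘(ℝ, V) x₀).symm y ∈ (extChartAt 𝓘(ℝ, V) x₁).source) :
    formInChart η x₀ =ᶠ[𝓝 y] fun z =>
      (formInChart η x₁ ((extChartAt 𝓘(ℝ, V) x₁ ∘ (extChartAt 𝓘(ℝ, V) x₀).symm) z)
        ).compContinuousLinearMap
          (fderiv ℝ (extChartAt 𝓘(ℝ, V) x₁ ∘ (extChartAt 𝓘(ℝ, V) x₀).symm) z) := by
  filter_upwards [eventually_mem_target_and_symm_mem_source hy hx₁] with z ⟨hz, hzx₁⟩
  rw [fderiv_transition hz hzx₁, Function.comp_apply, formInChart_apply η hzx₁]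
  ext v
  exact congrArg (η _) (funext fun i => (dChartInv_dChart hzx₁ _).symm)

theorem formInChart_extDer {k : ℕ} {η : DiffForm V M k} (hη : SmoothForm η) (x₀ : M) {y : V}
    (hy : y ∈ (extChartAt 𝓘(ℝ, V) x₀).target) :
    formInChart (extDer η) x₀ y = extDeriv (formInChart η x₀) y := by
  set x := (extChartAt 𝓘(ℝ, V) x₀).symm y
  have hsource : x ∈ (extChartAt 𝓘(ℝ, V) x).source := mem_extChartAt_source x
  rw [(formInChart_eventuallyEq_transition η hy hsource).extDeriv_eq,
    extDeriv_pullback (f := extChartAt 𝓘(ℝ, V) x ∘ (extChartAt 𝓘(ℝ, V) x₀).symm)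
      (hη.differentiableAt_inChart x) (contDiffAt_transition hy hsource)
      (by simpa using WithTop.coe_le_coe.2 (le_top : (2 : ℕ∞) ≤ ⊤)),
    fderiv_transition hy hsource]
  rfl

theorem formInChart_self {k : ℕ} (η : DiffForm V M k) (x : M) :
    formInChart η x (extChartAt 𝓘(ℝ, V) x x) = η x := by
  rw [formInChart_apply η (mem_extChartAt_source x), dChartInv_self]
  rfl

theorem extDer_eq {k : ℕ} (η : DiffForm V M k) (x : M) :
    extDer η x = extDeriv (formInChart η x) (extChartAt 𝓘(ℝ, V) x x) := by
  rw [extDer, dChart_self]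
  rfl

theorem multiVecInChart_self {k : ℕ} (P : MultiVecField V M k) (x : M) :
    multiVecInChart P x (extChartAt 𝓘(ℝ, V) x x) = P x := by
  rw [multiVecInChart, extChartAt_to_inv, dChart_self]
  rfl

end Charts

section AssociatedPair

variable {V : Type*} [NormedAddCommGroup V] [NormedSpace ℝ V] [FiniteDimensional ℝ V]
  {M : Type*} [TopologicalSpace M] [ChartedSpace V M]
  {ϑ : DiffForm V M 1} {ω : DiffForm V M 2} {L : MultiVecField V M 2} {E : VecField V M}

theorem isAssociatedPair_iff :
    IsAssociatedPair ϑ ω L E ↔ ∀ x, AssociatedAt (ϑ x) (extDer ϑ x + ω x) (L x) (E x) where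
  mp h x := ⟨h.reeb_one x, fun v => DFunLike.congr_fun (h.reeb_two x) ![v], h.sharp_one x,
    h.sharp_two x⟩
  mpr h := ⟨fun x => (h x).reeb_one, fun x => Form.ext_one (h x).reeb_two,
    fun x => (h x).sharp_one, fun x => (h x).sharp_two⟩

theorem IsTwistedContact.isAssociatedPair {n : ℕ} (h : IsTwistedContact n ϑ ω) :
    IsAssociatedPair ϑ ω (fun x => contactBivector (ϑ x) (extDer ϑ x + ω x))
      (fun x => reeb (ϑ x) (extDer ϑ x + ω x)) :=
  isAssociatedPair_iff.2 fun x =>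
    have hdim : Module.finrank ℝ (T V x) = 2 * n + 1 := h.finrank_eq
    (nondeg_of_wedge_ne_zero hdim (h.nonvanishing x)).associatedAt ⟨n, hdim⟩

theorem IsAssociatedPair.eq_contactBivector (h : IsAssociatedPair ϑ ω L E) :
    L = fun x => contactBivector (ϑ x) (extDer ϑ x + ω x) :=
  funext fun x => (isAssociatedPair_iff.1 h x).eq_contactBivector

theorem IsAssociatedPair.eq_reeb (h : IsAssociatedPair ϑ ω L E) :
    E = fun x => reeb (ϑ x) (extDer ϑ x + ω x) :=
  funext fun x => (isAssociatedPair_iff.1 h x).eq_reeb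

end AssociatedPair

section Global

open Topology

variable {V : Type*} [NormedAddCommGroup V] [NormedSpace ℝ V]
  {M : Type*} [TopologicalSpace M] [ChartedSpace V M]

/-- The expression of a vector field in the preferred chart at `x₀`. -/
noncomputable def vecInChart (E : VecField V M) (x₀ : M) (y : V) : V :=
  dChart V x₀ ((extChartAt 𝓘(ℝ, V) x₀).symm y) (E ((extChartAt 𝓘(ℝ, V) x₀).symm y))

theorem multiVecRInChart_pair (L : MultiVecField V M 2) (E : VecField V M) (x₀ : M) :
    multiVecRInChart (pair L E) x₀ =
      fun y => pairAt (multiVecInChart L x₀ y) (vecInChart E x₀ y) :=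
  funext fun _ => push_pairAt _ _ _

theorem pairSharp_eq [FiniteDimensional ℝ V] (L : MultiVecField V M 2) (E : VecField V M) (x : M) :
    pairSharp L E x = sharp (pairAt (L x) (E x)) :=
  ContinuousLinearMap.ext fun ζ => (sharp_pairAt (L x) (E x) ζ).symm

theorem schoutenMod_self [FiniteDimensional ℝ V] (P : MultiVecFieldR V M 2) (x : M) :
    (schoutenMod (p := 1) (q := 1) P P x : MultiVec 3 (T V x × ℝ)) =
      (schoutenR (p := 1) (q := 1) P P x : MultiVec 3 (T V x × ℝ))
        + (wedge (P x) (intProd (ContinuousLinearMap.snd ℝ (T V x) ℝ) (P x)) :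
          MultiVec 3 (T V x × ℝ))
        + (wedge (intProd (ContinuousLinearMap.snd ℝ (T V x) ℝ) (P x)) (P x) :
          MultiVec 3 (T V x × ℝ)) := by
  rw [schoutenMod, Nat.cast_one, mul_one, one_smul, neg_one_sq, one_smul]
  rfl

variable [IsManifold 𝓘(ℝ, V) (⊤ : ℕ∞) M]

theorem vecInChart_self (E : VecField V M) (x : M) :
    vecInChart E x (extChartAt 𝓘(ℝ, V) x x) = E x := by
  rw [vecInChart, extChartAt_to_inv, dChart_self]
  rfl

theorem smoothVecField_of_contDiffOn_vecInChart {E : VecField V M}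
    (h : ∀ x₀ : M,
      ContDiffOn ℝ (⊤ : ℕ∞) (vecInChart E x₀) (extChartAt 𝓘(ℝ, V) x₀).target) :
    SmoothVecField E := by
  intro x₀
  refine (Bundle.contMDiffAt_section x₀).2 ?_
  have hchart := (h x₀).contDiffAt (extChartAt_target_mem_nhds x₀)
  refine (hchart.contMDiffAt.comp x₀
    (contMDiffAt_extChartAt (I := 𝓘(ℝ, V)) (n := (⊤ : ℕ∞)))).congr_of_eventuallyEq ?_
  filter_upwards [extChartAt_source_mem_nhds (I := 𝓘(ℝ, V)) x₀] with x hx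
  rw [Function.comp_apply, vecInChart, (extChartAt 𝓘(ℝ, V) x₀).left_inv hx]
  rw [extChartAt_source] at hx
  have htriv := TangentBundle.continuousLinearMapAt_trivializationAt (I := 𝓘(ℝ, V)) hx
  refine Eq.trans ?_ (DFunLike.congr_fun htriv (E x))
  rw [Bundle.Trivialization.continuousLinearMapAt_apply,
    Bundle.Trivialization.linearMapAt_apply, if_pos]
  simpa using hx

variable [FiniteDimensional ℝ V]

theorem schouten_eq {p q : ℕ} (P : MultiVecField V M (p + 1)) (Q : MultiVecField V M (q + 1))
    (x : M) : schouten P Q x = schoutenFlat (ContinuousLinearMap.id ℝ V)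
      (multiVecInChart P x) (multiVecInChart Q x) (extChartAt 𝓘(ℝ, V) x x) := by
  rw [schouten, dChartInv_self]
  rfl

theorem schoutenR_eq {p q : ℕ} (P : MultiVecFieldR V M (p + 1)) (Q : MultiVecFieldR V M (q + 1))
    (x : M) : schoutenR P Q x = schoutenFlat (ContinuousLinearMap.fst ℝ V ℝ)
      (multiVecRInChart P x) (multiVecRInChart Q x) (extChartAt 𝓘(ℝ, V) x x) := by
  rw [schoutenR, dChartInv_self]
  rfl

variable {ϑ : DiffForm V M 1} {ω : DiffForm V M 2} {L : MultiVecField V M 2} {E : VecField V M}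

namespace IsAssociatedPair

theorem associatedAt_inChart (h : IsAssociatedPair ϑ ω L E) (hϑ : SmoothForm ϑ) (x₀ : M) {y : V}
    (hy : y ∈ (extChartAt 𝓘(ℝ, V) x₀).target) :
    AssociatedAt (formInChart ϑ x₀ y) (extDeriv (formInChart ϑ x₀) y + formInChart ω x₀ y)
      (multiVecInChart L x₀ y) (vecInChart E x₀ y) := by
  rw [← formInChart_extDer hϑ x₀ hy]
  obtain ⟨e, he⟩ := dChart_isInvertible ((extChartAt 𝓘(ℝ, V) x₀).map_target hy)
  have hmap := (isAssociatedPair_iff.1 h _).map e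
  rw [← ContinuousLinearMap.inverse_equiv, ← e.coe_coe, he] at hmap
  exact hmap

theorem eventually_associatedAt_inChart (h : IsAssociatedPair ϑ ω L E) (hϑ : SmoothForm ϑ)
    (x : M) :
    ∀ᶠ y in 𝓝 (extChartAt 𝓘(ℝ, V) x x), AssociatedAt (formInChart ϑ x y)
      (extDeriv (formInChart ϑ x) y + formInChart ω x y) (multiVecInChart L x y)
      (vecInChart E x y) :=
  Filter.eventually_of_mem (extChartAt_target_mem_nhds x) fun _ hy =>
    h.associatedAt_inChart hϑ x hy

theorem contDiffOn_vecInChart (h : IsAssociatedPair ϑ ω L E) (hϑ : SmoothForm ϑ)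
    (hω : SmoothForm ω) (x₀ : M) :
    ContDiffOn ℝ (⊤ : ℕ∞) (vecInChart E x₀) (extChartAt 𝓘(ℝ, V) x₀).target :=
  contDiffOn_reeb (hϑ x₀)
    ((contDiffOn_extDeriv (isOpen_extChartAt_target x₀) (hϑ x₀)).add (hω x₀))
    fun _ hy => h.associatedAt_inChart hϑ x₀ hy

theorem smoothMultiVecField (h : IsAssociatedPair ϑ ω L E) (hϑ : SmoothForm ϑ)
    (hω : SmoothForm ω) : SmoothMultiVecField L := fun x₀ =>
  contDiffOn_bivector (hϑ x₀)
    ((contDiffOn_extDeriv (isOpen_extChartAt_target x₀) (hϑ x₀)).add (hω x₀))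
    fun _ hy => h.associatedAt_inChart hϑ x₀ hy

theorem smoothVecField (h : IsAssociatedPair ϑ ω L E) (hϑ : SmoothForm ϑ) (hω : SmoothForm ω) :
    SmoothVecField E :=
  smoothVecField_of_contDiffOn_vecInChart (h.contDiffOn_vecInChart hϑ hω)

theorem differentiableAt_vecInChart (h : IsAssociatedPair ϑ ω L E) (hϑ : SmoothForm ϑ)
    (hω : SmoothForm ω) (x : M) :
    DifferentiableAt ℝ (vecInChart E x) (extChartAt 𝓘(ℝ, V) x x) :=
  ((h.contDiffOn_vecInChart hϑ hω x).contDiffAt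
    (extChartAt_target_mem_nhds x)).differentiableAt (by simp)

theorem differentiableAt_multiVecInChart (h : IsAssociatedPair ϑ ω L E) (hϑ : SmoothForm ϑ)
    (hω : SmoothForm ω) (x : M) :
    DifferentiableAt ℝ (multiVecInChart L x) (extChartAt 𝓘(ℝ, V) x x) :=
  ((h.smoothMultiVecField hϑ hω x).contDiffAt
    (extChartAt_target_mem_nhds x)).differentiableAt (by simp)

theorem twistedJacobiEq₁ (h : IsAssociatedPair ϑ ω L E) (hϑ : SmoothForm ϑ)
    (hω : SmoothForm ω) : TwistedJacobiEq₁ L E ω := fun x => by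
  have hflat := flat_twistedJacobiEq₁ (h.eventually_associatedAt_inChart hϑ x)
    (hϑ.contDiffAt_two_inChart x) (hω.differentiableAt_inChart x)
    (h.differentiableAt_multiVecInChart hϑ hω x)
  rw [← schouten_eq, ← extDer_eq, multiVecInChart_self, vecInChart_self,
    formInChart_self] at hflat
  exact hflat

theorem twistedJacobiEq₂ (h : IsAssociatedPair ϑ ω L E) (hϑ : SmoothForm ϑ)
    (hω : SmoothForm ω) : TwistedJacobiEq₂ L E ω := fun x => by
  have hflat := flat_twistedJacobiEq₂ (h.eventually_associatedAt_inChart hϑ x)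
    (hϑ.contDiffAt_two_inChart x) (hω.differentiableAt_inChart x)
    (h.differentiableAt_multiVecInChart hϑ hω x) (h.differentiableAt_vecInChart hϑ hω x)
  rw [← extDer_eq, multiVecInChart_self, vecInChart_self, formInChart_self] at hflat
  exact (schouten_eq (p := 0) (q := 1) (fun z => vec (E z)) L x).trans hflat

theorem isTwistedJacobi (h : IsAssociatedPair ϑ ω L E) (hϑ : SmoothForm ϑ)
    (hω : SmoothForm ω) : IsTwistedJacobi L E ω where
  smooth_bivector := h.smoothMultiVecField hϑ hω
  smooth_vector := h.smoothVecField hϑ hω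
  smooth_form := hω
  equation x := by
    have hflat := flat_isTwistedJacobi_equation (h.eventually_associatedAt_inChart hϑ x)
      (hϑ.contDiffAt_two_inChart x) (hω.differentiableAt_inChart x)
      (h.differentiableAt_multiVecInChart hϑ hω x) (h.differentiableAt_vecInChart hϑ hω x)
    rw [← multiVecRInChart_pair, ← schoutenR_eq, ← extDer_eq, multiVecInChart_self,
      vecInChart_self, formInChart_self] at hflat
    rw [schoutenMod_self, pairSharp_eq]
    exact hflat

end IsAssociatedPair

end Global

end TwistedJacobi

theorem mainTheorem3
    {V : Type*} [NormedAddCommGroup V] [NormedSpace ℝ V] [FiniteDimensional ℝ V]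
    {M : Type*} [TopologicalSpace M] [ChartedSpace V M] [IsManifold 𝓘(ℝ, V) (⊤ : ℕ∞) M]
    (n : ℕ) (ϑ : DiffForm V M 1) (ω : DiffForm V M 2) (h : IsTwistedContact n ϑ ω) :
    ∃ (L : MultiVecField V M 2) (E : VecField V M),
      IsAssociatedPair ϑ ω L E ∧
      (∀ (L' : MultiVecField V M 2) (E' : VecField V M),
        IsAssociatedPair ϑ ω L' E' → L' = L ∧ E' = E) ∧
      SmoothMultiVecField L ∧ SmoothVecField E ∧
      TwistedJacobiEq₁ L E ω ∧ TwistedJacobiEq₂ L E ω ∧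
      IsTwistedJacobi L E ω := by
  have hpair := h.isAssociatedPair
  have hϑ := h.smooth_one
  have hω := h.smooth_two
  exact ⟨_, _, hpair, fun _ _ hpair' => ⟨hpair'.eq_contactBivector, hpair'.eq_reeb⟩,
    hpair.smoothMultiVecField hϑ hω, hpair.smoothVecField hϑ hω,
    hpair.twistedJacobiEq₁ hϑ hω, hpair.twistedJacobiEq₂ hϑ hω, hpair.isTwistedJacobi hϑ hω⟩
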